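/- Let $d\ge 1$. A spacetime on $\mathbb{R}^{d+1}$ is a smooth Lorentzian metric $g$ (signature $(-,+,\dots,+)$) on $\mathbb{R}^{d+1}$. Write $g\simeq_{\mathrm{diff}}\tilde g$ if there is a smooth diffeomorphism $\varphi$ of $\mathbb{R}^{d+1}$ onto itself with $g=\varphi^*\tilde g$, i.e. $g_{\mu\nu}(x)=\partial_\mu\varphi^\rho(x)\,\partial_\nu\varphi^\sigma(x)\,\tilde g_{\rho\sigma}(\varphi(x))$. Sets of spacetimes carry the $C^\infty$ compact-open topology. A continuous action $G\curvearrowright X$ of a Polish group on a Polish space is *generically ergodic* if some orbit is dense and every orbit is meager. A set $\mathcal S$ of spacetimes is *rich* if there are a generically ergodic such action $G\curvearrowright X$ and a Borel map $r\colon X\to\mathcal S$ which is a reduction, that is, for all $a,b\in X$: $G\cdot a=G\cdot b \iff r(a)\simeq_{\mathrm{diff}} r(b)$. Let $\mathrm{RW}(\mathbb{R}^{d+1})$ be the set of all Robertson-Walker metrics $$-dt^2+J(t)\big((dx^1)^2+\cdots+(dx^d)^2\big),\qquad J\colon\mathbb{R}\to(0,\infty)\ \text{smooth}.$$ Let $\mathbb{Z}$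 act on $\{0,1\}^{\mathbb{Z}}$ (product topology) by the Bernoulli shift $(k\cdot\alpha)(n)=\alpha(n-k)$. Call $W\colon[0,1]\to[0,1]$ a *bell curve* if $W$ is smooth, $W$ and all its derivatives vanish at $0$ and $1$, $W(p)=1$ for a unique $p\in[0,1]$, this $p$ satisfies $p<1/2$, and the graph of the $1$-periodic extension of $W$ is not symmetric about any vertical axis. For $\alpha\in\{0,1\}^{\mathbb Z}$ set $W_\alpha(t)=2-W(t-\lfloor t\rfloor)$ if $\alpha(\lfloor t\rfloor)=0$ and $W_\alpha(t)=2+W(t-\lfloor t\rfloor)$ if $\alpha(\lfloor t\rfloor)=1$. Then: 1. $\mathrm{RW}(\mathbb{R}^{d+1})$ is rich. 2. The Bernoulli shift is a generically ergodic action of a Polish group on a Polish space, bell curves exist, and for every bell curve $W$ the assignment $r(\alpha)=-dt^2+W_\alpha(t)\sum_{i=1}^d(dx^i)^2$ is a well-defined continuous (hence Borel) map $r\colon\{0,1\}^{\mathbb{Z}}\to\mathrm{RW}(\mathbb{R}^{d+1})$ and a reduction of the orbit equivalence relation of the Bernoulli shift to $\simeq_{\mathrm{diff}}$. 3. More precisely,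 for every bell curve $W$ and all $\alpha,\beta\in\{0,1\}^{\mathbb Z}$, every diffeomorphism $\varphi$ of $\mathbb{R}^{d+1}$ with $r(\alpha)=\varphi^*r(\beta)$ shifts $t$ by an integer: there is $k\in\mathbb{Z}$ with $\varphi^0(t,x)=t-k$ for all $(t,x)$, and $\alpha(n)=\beta(n-k)$ for all $n\in\mathbb{Z}$. -/

import Mathlib

open Set
open scoped ContDiff Manifold

/-! ### Spacetimes on `ℝ^{d+1}` and general covariance -/

/-- The manifold `ℝ^{d+1}`, with coordinates `x 0 = t` and `x 1, …, x d`. -/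
abbrev Coord (d : ℕ) : Type := EuclideanSpace ℝ (Fin (d + 1))

/-- Bilinear forms on the tangent space `ℝ^{d+1}`. -/
abbrev BilForm (d : ℕ) : Type := Coord d →L[ℝ] Coord d →L[ℝ] ℝ

/-- Lorentzian signature `(-, +, …, +)`: there is a basis in which the form is
`diag (-1, 1, …, 1)`. -/
def IsLorentzian {d : ℕ} (B : BilForm d) : Prop :=
  ∃ e : Module.Basis (Fin (d + 1)) ℝ (Coord d), ∀ i j : Fin (d + 1),
    B (e i) (e j) = if i = j then (if i = 0 then -1 else 1) else 0

/-- A smooth spacetime supported on `ℝ^{d+1}`: a smooth Lorentzian metric tensor field. -/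
structure Spacetime (d : ℕ) where
  /-- the metric tensor at each point -/
  metric : Coord d → BilForm d
  smooth : ContDiff ℝ ∞ metric
  symm : ∀ x v w, metric x v w = metric x w v
  lorentzian : ∀ x, IsLorentzian (metric x)

/-- The `n`-th derivative of a smooth map, as a continuous map. -/
noncomputable def smoothJet {E F : Type} [NormedAddCommGroup E] [NormedSpace ℝ E]
    [NormedAddCommGroup F] [NormedSpace ℝ F] (n : ℕ) (f : {f : E → F // ContDiff ℝ ∞ f}) :
    C(E, ContinuousMultilinearMap ℝ (fun _ : Fin n => E) F) :=
  ⟨iteratedFDeriv ℝ n f.1,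
    f.2.continuous_iteratedFDeriv (by exact_mod_cast (le_top : (n : ℕ∞) ≤ ⊤))⟩

/-- The `C^∞` compact-open topology on smooth maps: uniform convergence on compact sets of the
maps together with all their derivatives. -/
noncomputable abbrev smoothTopology (E F : Type) [NormedAddCommGroup E] [NormedSpace ℝ E]
    [NormedAddCommGroup F] [NormedSpace ℝ F] : TopologicalSpace {f : E → F // ContDiff ℝ ∞ f} :=
  ⨅ n : ℕ, TopologicalSpace.induced (smoothJet n) inferInstance

/-- Spacetimes carry the `C^∞` compact-open topology of their metric tensor fields. -/
noncomputable instance Spacetime.instTopologicalSpace (d : ℕ) : TopologicalSpace (Spacetime d) :=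
  TopologicalSpace.induced (fun g => ⟨g.metric, g.smooth⟩)
    (smoothTopology (Coord d) (BilForm d))

/-- Smooth changes of coordinates of `ℝ^{d+1}` (diffeomorphisms onto itself). -/
abbrev CoordChange (d : ℕ) : Type :=
  Diffeomorph 𝓘(ℝ, Coord d) 𝓘(ℝ, Coord d) (Coord d) (Coord d) ∞

/-- The coordinate change `x ↦ φ x` carries `g` to `g'`, that is,
`g_{μν}(x) = ∂_μ φ^ρ(x) ∂_ν φ^σ(x) g'_{ρσ}(φ x)`. -/
def Transforms {d : ℕ} (φ : CoordChange d) (g g' : Spacetime d) : Prop :=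
  ∀ x v w : Coord d,
    g.metric x v w = g'.metric (φ x) (fderiv ℝ φ x v) (fderiv ℝ φ x w)

/-- General covariance `g ≃_diff g'`. -/
def DiffEquivalent {d : ℕ} (g g' : Spacetime d) : Prop :=
  ∃ φ : CoordChange d, Transforms φ g g'

/-! ### Rich families -/

/-- `G ↷ X` is a Polish `G`-space (a continuous action of a Polish group on a Polish space) which
is generically ergodic: some orbit is dense, and every orbit is meager. -/
structure IsGenericallyErgodicPolish (G X : Type) [Group G] [TopologicalSpace G]
    [TopologicalSpace X] [MulAction G X] : Prop where
  topologicalGroup : IsTopologicalGroup G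
  polish_group : PolishSpace G
  polish_space : PolishSpace X
  continuous_action : ContinuousSMul G X
  dense_orbit : ∃ x : X, Dense (MulAction.orbit G x)
  meagre_orbits : ∀ x : X, IsMeagre (MulAction.orbit G x)

/-- `r` is a Borel reduction of the orbit equivalence relation of `G ↷ X` to general covariance
on the family `S`, which carries the `C^∞` compact-open topology. -/
structure IsBorelReduction (G : Type) {X : Type} [Group G] [TopologicalSpace X] [MulAction G X]
    {d : ℕ} {S : Set (Spacetime d)} (r : X → S) : Prop where
  borel_map : @Measurable X S (borel X) (borel S) r
  reduces : ∀ a b : X, MulAction.orbit G a = MulAction.orbit G b ↔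
    DiffEquivalent (r a : Spacetime d) (r b : Spacetime d)

/-- A family of spacetimes is rich if the orbit equivalence relation of some generically ergodic
Polish `G`-space Borel reduces to general covariance on it. -/
def IsRich {d : ℕ} (S : Set (Spacetime d)) : Prop :=
  ∃ (G X : Type) (_ : Group G) (_ : TopologicalSpace G) (_ : TopologicalSpace X)
    (_ : MulAction G X),
    IsGenericallyErgodicPolish G X ∧ ∃ r : X → S, IsBorelReduction G r

/-! ### Robertson-Walker spacetimes -/

/-- `g = -dt² + J(t) ((dx¹)² + ⋯ + (dx^d)²)`. -/
def HasRWForm {d : ℕ} (J : ℝ → ℝ) (g : Spacetime d) : Prop :=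
  ∀ x v w : Coord d,
    g.metric x v w = -(v 0 * w 0) + J (x 0) * ∑ i : Fin d, v i.succ * w i.succ

/-- The family of all `(d+1)`-dimensional Robertson-Walker spacetimes. -/
def RW (d : ℕ) : Set (Spacetime d) :=
  {g | ∃ J : ℝ → ℝ, ContDiff ℝ ∞ J ∧ (∀ t, 0 < J t) ∧ HasRWForm J g}

/-! ### The Bernoulli shift and the functions `W_α` -/

/-- The space `{0,1}^ℤ` (with `1 = true`). -/
def Bernoulli : Type := ℤ → Bool

/-- The product topology. -/
instance Bernoulli.instTopologicalSpace : TopologicalSpace Bernoulli :=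
  inferInstanceAs (TopologicalSpace (ℤ → Bool))

/-- The shift action `(k · α)(n) = α (n - k)` of `ℤ` (written multiplicatively). -/
instance Bernoulli.instMulAction : MulAction (Multiplicative ℤ) Bernoulli where
  smul k α := fun n => α (n - k.toAdd)
  one_smul α := by
    funext n
    change α (n - 0) = α n
    rw [sub_zero]
  mul_smul k l α := by
    funext n
    change α (n - (k.toAdd + l.toAdd)) = α (n - k.toAdd - l.toAdd)
    rw [sub_sub]

/-- The bell curves `W : [0,1] → [0,1]` (values of `W` outside `[0,1]` are irrelevant). -/
structure IsBellCurve (W : ℝ → ℝ) : Prop where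
  smooth : ContDiffOn ℝ ∞ W (Icc 0 1)
  mapsTo : MapsTo W (Icc 0 1) (Icc 0 1)
  flat_zero : ∀ n : ℕ, iteratedDerivWithin n W (Icc 0 1) 0 = 0
  flat_one : ∀ n : ℕ, iteratedDerivWithin n W (Icc 0 1) 1 = 0
  peak : ∃ p ∈ Icc (0 : ℝ) 1, p < 1 / 2 ∧ W p = 1 ∧ ∀ x ∈ Icc (0 : ℝ) 1, W x = 1 → x = p
  /-- the graph of the `1`-periodic extension of `W` has no vertical axis of symmetry -/
  asymmetric : ¬ ∃ c : ℝ, ∀ t : ℝ, W (Int.fract (2 * c - t)) = W (Int.fract t)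

/-- `W_α(t) = 2 - W(t - ⌊t⌋)` if `α(⌊t⌋) = 0`, and `2 + W(t - ⌊t⌋)` if `α(⌊t⌋) = 1`. -/
noncomputable def bellWave (W : ℝ → ℝ) (α : Bernoulli) (t : ℝ) : ℝ :=
  if α ⌊t⌋ = true then 2 + W (t - ⌊t⌋) else 2 - W (t - ⌊t⌋)

/-! The core is rigidity. Let `φ` be an isometry from `-dt² + J dx²` to `-dt² + K dx²`, let `T =
φ⁰`, and let `H`, `L` be the Hubble functions of `J` and `K`. In the target the covariant Hessian of
time is `-L (g' + dt ⊗ dt)`; pulling it back gives an explicit second-order system for `T`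
(`hessian_time`).

Equality of the mixed third derivatives `∂ₜ∂ᵢ∂ᵢT` and `∂ᵢ∂ₜ∂ᵢT` then yields `a''/a` at `t` equal to
its target counterpart at `T` (`acceleration_eq`), where `a = √J`. If some `∂ᵢT` is nonzero at one
point, a conserved quantity keeps it nonzero along the whole `t`-line (`momentum_eq`).
Differentiating the curvature identity in `xⁱ` and in `t` on this line shows that `a''/a` is
constant. If moreover `J' = J'' = 0` at some time, that constant is `0`, so `a'' = 0`, and `a' = 0`
at that time makes `J` constant. The function `W_α` is flat at the integers and not constant, hence
`T` depends on `t` only. Then `(∂ₜT)² = 1`, so `T = ±t + s`, and `J` is a multiple `c` of `K ∘ T`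
(`exists_affine_time`).

For `J = W_α` and `K = W_β` the ratio of maximum to minimum forces `c = 1`, asymmetry of the bell
excludes the sign `-1`, and uniqueness of its peak makes `s` an integer; the values at the peaks
recover the letters. Conversely, shifts act by time translations. Finally, the Bernoulli shift has
countable orbits in a space without isolated points, and a sequence containing every finite word has
a dense orbit. -/

namespace Bernoulli

/-! ### Generic ergodicity of the Bernoulli shift -/

instance : PolishSpace Bernoulli := by
  have h : TopologicalSpace.IsCompletelyMetrizableSpace (ℤ → Bool) := inferInstance
  have h' : SecondCountableTopology (ℤ → Bool) := inferInstance
  exact @PolishSpace.mk (ℤ → Bool) _ h' h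

theorem smul_apply (k : Multiplicative ℤ) (α : Bernoulli) (n : ℤ) :
    (k • α) n = α (n - k.toAdd) := rfl

theorem continuous_eval (n : ℤ) : Continuous fun α : Bernoulli => α n :=
  continuous_apply (A := fun _ : ℤ => Bool) n

theorem setOf_eqOn_mem_nhds (α : Bernoulli) (N : ℕ) :
    {β : Bernoulli | ∀ n : ℤ, -N ≤ n → n ≤ N → β n = α n} ∈ nhds α := by
  have h : {β : Bernoulli | ∀ n : ℤ, -N ≤ n → n ≤ N → β n = α n} =
      ⋂ n ∈ Icc (-N : ℤ) N, {β : Bernoulli | β n = α n} := by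
    ext β
    simp only [mem_ofPred_eq, mem_iInter, mem_Icc, and_imp]
  rw [h, Filter.biInter_mem (Set.finite_Icc _ _)]
  intro n _
  exact (continuous_eval n).continuousAt.preimage_mem_nhds
    ((isOpen_discrete {α n}).mem_nhds rfl)

theorem exists_setOf_eqOn_subset {α : Bernoulli} {U : Set Bernoulli} (hU : U ∈ nhds α) :
    ∃ N : ℕ, {β : Bernoulli | ∀ n : ℤ, -N ≤ n → n ≤ N → β n = α n} ⊆ U := by
  have hU' : U ∈ Filter.pi fun n : ℤ => nhds (α n) :=
    nhds_pi (A := fun _ : ℤ => Bool) (a := α) ▸ hU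
  obtain ⟨I, hI, t, ht, hsub⟩ := Filter.mem_pi.1 hU'
  obtain ⟨N, hN⟩ : ∃ N : ℕ, ∀ n ∈ I, n.natAbs ≤ N := by
    obtain ⟨N, hN⟩ := (hI.image Int.natAbs).bddAbove
    exact ⟨N, fun n hn => hN (mem_image_of_mem _ hn)⟩
  refine ⟨N, fun β hβ => hsub fun n hn => ?_⟩
  have h1 := hN n hn
  rw [hβ n (by omega) (by omega)]
  exact mem_of_mem_nhds (ht n)

/-- A sequence containing every finite word: the binary digits of `m` are written from position
`2 ^ m` on. -/
def universal : Bernoulli := fun n =>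
  (Nat.log 2 n.toNat).testBit (n.toNat - 2 ^ Nat.log 2 n.toNat)

theorem universal_apply {m i : ℕ} (hi : i < 2 ^ m) :
    universal ((2 ^ m + i : ℕ) : ℤ) = m.testBit i := by
  have h : Nat.log 2 (2 ^ m + i) = m :=
    Nat.log_eq_of_pow_le_of_lt_pow (by omega) (by rw [pow_succ]; omega)
  simp only [universal, Int.toNat_natCast, h, Nat.add_sub_cancel_left]

/-- Every finite word is the initial segment of the binary digits, least significant first, of some
`m`, and those digits are written out from position `2 ^ m`. -/
theorem exists_universal_word (f : ℕ → Bool) (l : ℕ) :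
    ∃ j : ℤ, ∀ i < l, universal (j + i) = f i := by
  -- The extra top bit at position `l` forces `m ≥ 2 ^ l > l`, so the word fits in the block of
  -- length `2 ^ m` reserved for `m`.
  set m := Nat.ofBits (fun i : Fin (l + 1) => if (i : ℕ) < l then f i else true) with hm
  have hbit : ∀ i, i < l → m.testBit i = f i := fun i hi => by
    rw [hm, Nat.testBit_ofBits_lt _ _ (by omega)]
    simp [hi]
  have htop : m.testBit l = true := by
    rw [hm, Nat.testBit_ofBits_lt _ _ (by omega)]
    simp
  have hl : 2 ^ l ≤ m := Nat.ge_two_pow_of_testBit htop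
  have h1 : l < m := Nat.lt_two_pow_self.trans_le hl
  have h2 : m < 2 ^ m := Nat.lt_two_pow_self
  refine ⟨((2 ^ m : ℕ) : ℤ), fun i hi => ?_⟩
  have := universal_apply (m := m) (i := i) (by omega)
  rw [Nat.cast_add] at this
  rw [this, hbit i hi]

theorem dense_orbit_universal : Dense (MulAction.orbit (Multiplicative ℤ) universal) := by
  intro α
  rw [mem_closure_iff_nhds]
  intro U hU
  obtain ⟨N, hN⟩ := exists_setOf_eqOn_subset hU
  obtain ⟨j, hj⟩ := exists_universal_word (fun i => α ((i : ℤ) - N)) (2 * N + 1)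
  -- This shift moves the copy of the word starting at `j` onto the window from `-N` to `N`.
  refine ⟨Multiplicative.ofAdd (-j - N) • universal, hN fun n h1 h2 => ?_, ⟨_, rfl⟩⟩
  have h3 := hj (n + N).toNat (by omega)
  rw [Int.toNat_of_nonneg (by omega)] at h3
  rw [smul_apply, toAdd_ofAdd, show n - (-j - (N : ℤ)) = j + (n + N) by ring, h3]
  congr 1
  ring

theorem isNowhereDense_singleton (α : Bernoulli) : IsNowhereDense ({α} : Set Bernoulli) := by
  rw [isClosed_singleton.isNowhereDense_iff, eq_empty_iff_forall_notMem]
  intro β hβ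
  have hβα : β = α := mem_singleton_iff.1 (interior_subset hβ)
  subst hβα
  obtain ⟨N, hN⟩ := exists_setOf_eqOn_subset (mem_interior_iff_mem_nhds.1 hβ)
  -- Flipping the letter just outside the window gives a second point of the neighbourhood.
  have h : (fun n : ℤ => if n = N + 1 then !(β n) else β n) = β :=
    hN (fun n _ h2 => if_neg (by omega))
  have := congrFun h ((N : ℤ) + 1)
  simp at this

theorem isMeagre_orbit (α : Bernoulli) : IsMeagre (MulAction.orbit (Multiplicative ℤ) α) := by
  have h : MulAction.orbit (Multiplicative ℤ) α =
      ⋃ k : Multiplicative ℤ, {k • α} := by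
    ext β
    simp [MulAction.mem_orbit_iff, eq_comm]
  rw [h]
  have : Countable (Multiplicative ℤ) := inferInstanceAs (Countable ℤ)
  exact isMeagre_iUnion fun k => (isNowhereDense_singleton _).isMeagre

theorem isGenericallyErgodicPolish :
    IsGenericallyErgodicPolish (Multiplicative ℤ) Bernoulli where
  topologicalGroup := inferInstance
  polish_group := inferInstanceAs (PolishSpace ℤ)
  polish_space := inferInstance
  continuous_action := by
    refine ⟨continuous_prod_of_discrete_left.2 fun k => ?_⟩
    exact continuous_pi (A := fun _ : ℤ => Bool) fun n => continuous_eval (n - k.toAdd)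
  dense_orbit := ⟨universal, dense_orbit_universal⟩
  meagre_orbits := isMeagre_orbit

end Bernoulli

/-! ### A bell curve -/

theorem iteratedDeriv_eq_zero_of_eqOn_Iio {f : ℝ → ℝ} (hf : ContDiff ℝ ∞ f) {a : ℝ}
    (h : ∀ x < a, f x = 0) (n : ℕ) : iteratedDeriv n f a = 0 := by
  have hc : Continuous (iteratedDeriv n f) :=
    hf.continuous_iteratedDeriv n (by exact_mod_cast (le_top : (n : ℕ∞) ≤ ⊤))
  have h0 : EqOn (iteratedDeriv n f) (fun _ => 0) (Iio a) := by
    intro x hx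
    have : f =ᶠ[nhds x] fun _ => 0 := by
      filter_upwards [isOpen_Iio.mem_nhds hx] with y hy using h y hy
    simpa using (this.iteratedDeriv_eq n)
  have := h0.closure hc continuous_const
  rw [closure_Iio] at this
  exact this self_mem_Iic

theorem iteratedDeriv_eq_zero_of_eqOn_Ioi {f : ℝ → ℝ} (hf : ContDiff ℝ ∞ f) {a : ℝ}
    (h : ∀ x > a, f x = 0) (n : ℕ) : iteratedDeriv n f a = 0 := by
  have hc : Continuous (iteratedDeriv n f) :=
    hf.continuous_iteratedDeriv n (by exact_mod_cast (le_top : (n : ℕ∞) ≤ ⊤))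
  have h0 : EqOn (iteratedDeriv n f) (fun _ => 0) (Ioi a) := by
    intro x hx
    have : f =ᶠ[nhds x] fun _ => 0 := by
      filter_upwards [isOpen_Ioi.mem_nhds hx] with y hy using h y hy
    simpa using (this.iteratedDeriv_eq n)
  have := h0.closure hc continuous_const
  rw [closure_Ioi] at this
  exact this self_mem_Ici

/-- `exp (9 - 1/x - 4/(1-x))` on `(0,1)`, extended by zero. -/
noncomputable def skewBell (x : ℝ) : ℝ :=
  Real.exp 9 * (expNegInvGlue x * expNegInvGlue ((1 - x) / 4))

theorem contDiff_skewBell : ContDiff ℝ ∞ skewBell := by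
  unfold skewBell
  have h : ContDiff ℝ ∞ expNegInvGlue := expNegInvGlue.contDiff
  have h2 : ContDiff ℝ ∞ fun x : ℝ => expNegInvGlue ((1 - x) / 4) := h.comp (by fun_prop)
  exact contDiff_const.mul (h.mul h2)

theorem skewBell_of_nonpos {x : ℝ} (hx : x ≤ 0) : skewBell x = 0 := by
  simp [skewBell, expNegInvGlue.zero_of_nonpos hx]

theorem skewBell_of_one_le {x : ℝ} (hx : 1 ≤ x) : skewBell x = 0 := by
  simp [skewBell, expNegInvGlue.zero_of_nonpos (show (1 - x) / 4 ≤ 0 by linarith)]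

/-- Completing the square: `1/x + 4/(1-x)` has minimum `9` on the interval, attained only at `1/3`.
Hence the constant `9` in the definition, and the weight `4`, which moves the peak off the centre.
-/
theorem skewBell_of_mem_Ioo {x : ℝ} (hx : x ∈ Ioo (0 : ℝ) 1) :
    skewBell x = Real.exp (-((3 * x - 1) ^ 2 / (x * (1 - x)))) := by
  have h0 : x ≠ 0 := hx.1.ne'
  have h1 : (1 : ℝ) - x ≠ 0 := (sub_pos.2 hx.2).ne'
  have h2 : ¬ (1 - x) / 4 ≤ 0 := by have := hx.2; simp only [not_le]; linarith
  rw [skewBell, expNegInvGlue, expNegInvGlue, if_neg (not_le.2 hx.1), if_neg h2, ← Real.exp_add,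
    ← Real.exp_add]
  congr 1
  field_simp
  ring

theorem skewBell_nonneg (x : ℝ) : 0 ≤ skewBell x :=
  mul_nonneg (Real.exp_pos _).le (mul_nonneg (expNegInvGlue.nonneg _) (expNegInvGlue.nonneg _))

theorem skewBell_le_one (x : ℝ) : skewBell x ≤ 1 := by
  rcases le_or_gt x 0 with h | h
  · rw [skewBell_of_nonpos h]; exact zero_le_one
  rcases le_or_gt 1 x with h' | h'
  · rw [skewBell_of_one_le h']; exact zero_le_one
  rw [skewBell_of_mem_Ioo ⟨h, h'⟩, Real.exp_le_one_iff, neg_nonpos]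
  exact div_nonneg (sq_nonneg _) (mul_pos h (sub_pos.2 h')).le

theorem skewBell_eq_one_iff {x : ℝ} : skewBell x = 1 ↔ x = 1 / 3 := by
  rcases le_or_gt x 0 with h | h
  · rw [skewBell_of_nonpos h]
    constructor
    · intro h; norm_num at h
    · intro h; linarith
  rcases le_or_gt 1 x with h' | h'
  · rw [skewBell_of_one_le h']
    constructor
    · intro h; norm_num at h
    · intro h; linarith
  rw [skewBell_of_mem_Ioo ⟨h, h'⟩, Real.exp_eq_one_iff, neg_eq_zero,
    div_eq_zero_iff, or_iff_left (mul_pos h (sub_pos.2 h')).ne', sq_eq_zero_iff]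
  constructor <;> intro h <;> linarith

theorem isBellCurve_skewBell : IsBellCurve skewBell where
  smooth := contDiff_skewBell.contDiffOn
  mapsTo x _ := ⟨skewBell_nonneg x, skewBell_le_one x⟩
  flat_zero n := by
    rw [iteratedDerivWithin_eq_iteratedDeriv (uniqueDiffOn_Icc zero_lt_one)
      (contDiff_skewBell.of_le (by exact_mod_cast (le_top : (n : ℕ∞) ≤ ⊤))).contDiffAt
      (left_mem_Icc.2 zero_le_one)]
    exact iteratedDeriv_eq_zero_of_eqOn_Iio contDiff_skewBell
      (fun x hx => skewBell_of_nonpos hx.le) n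
  flat_one n := by
    rw [iteratedDerivWithin_eq_iteratedDeriv (uniqueDiffOn_Icc zero_lt_one)
      (contDiff_skewBell.of_le (by exact_mod_cast (le_top : (n : ℕ∞) ≤ ⊤))).contDiffAt
      (right_mem_Icc.2 zero_le_one)]
    exact iteratedDeriv_eq_zero_of_eqOn_Ioi contDiff_skewBell
      (fun x hx => skewBell_of_one_le hx.le) n
  peak := ⟨1 / 3, by constructor <;> norm_num, by norm_num, skewBell_eq_one_iff.2 rfl,
    fun x _ hx => skewBell_eq_one_iff.1 hx⟩
  asymmetric := by
    rintro ⟨c, hc⟩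
    -- A reflection must preserve the peak `1/3` modulo `1`, so `2c ≡ 2/3`. It then sends the zero
    -- at `0` to `2/3`, where the bell is positive.
    have h1 := hc (1 / 3)
    have h13 : Int.fract (1 / 3 : ℝ) = 1 / 3 := Int.fract_eq_self.2 (by constructor <;> norm_num)
    rw [h13, skewBell_eq_one_iff.2 rfl, skewBell_eq_one_iff] at h1
    have h2 := hc 0
    have h3 : Int.fract (2 * c - 0) = 2 / 3 := by
      rw [Int.fract_eq_iff]
      refine ⟨by norm_num, by norm_num, ⌊2 * c - 1 / 3⌋, ?_⟩
      have := Int.floor_add_fract (2 * c - 1 / 3)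
      linarith
    rw [h3, Int.fract_zero, skewBell_of_nonpos le_rfl,
      skewBell_of_mem_Ioo (by constructor <;> norm_num)] at h2
    exact (Real.exp_pos _).ne' h2

/-! ### Smoothness of the functions `W_α` -/

/-- The `n`-th derivative of `W` on `[0,1]`, extended by zero. -/
noncomputable def flatExtension (W : ℝ → ℝ) (n : ℕ) : ℝ → ℝ :=
  indicator (Icc 0 1) (iteratedDerivWithin n W (Icc 0 1))

namespace IsBellCurve

variable {W : ℝ → ℝ}

theorem flatExtension_of_nonpos (hW : IsBellCurve W) (n : ℕ) {t : ℝ} (ht : t ≤ 0) :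
    flatExtension W n t = 0 := by
  rcases ht.eq_or_lt with rfl | ht
  · rw [flatExtension, indicator_of_mem (left_mem_Icc.2 zero_le_one), hW.flat_zero]
  · exact indicator_of_notMem (fun h => ht.not_ge h.1) _

theorem flatExtension_of_one_le (hW : IsBellCurve W) (n : ℕ) {t : ℝ} (ht : 1 ≤ t) :
    flatExtension W n t = 0 := by
  rcases ht.eq_or_lt with rfl | ht
  · rw [flatExtension, indicator_of_mem (right_mem_Icc.2 zero_le_one), hW.flat_one]
  · exact indicator_of_notMem (fun h => ht.not_ge h.2) _

theorem flatExtension_zero_of_mem {t : ℝ} (ht : t ∈ Icc (0 : ℝ) 1) :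
    flatExtension W 0 t = W t := by
  rw [flatExtension, indicator_of_mem ht, iteratedDerivWithin_zero]

/-- The closed sets `Iic 0`, `Icc 0 1`, `Ici 1` cover the line, and flatness makes the one-sided
derivatives agree at the seams. Off the closure of a set, a derivative within it holds vacuously, so
the three statements can be united at every `t`. -/
theorem hasDerivAt_flatExtension (hW : IsBellCurve W) (n : ℕ) (t : ℝ) :
    HasDerivAt (flatExtension W n) (flatExtension W (n + 1) t) t := by
  have h1 : HasDerivWithinAt (flatExtension W n) (flatExtension W (n + 1) t) (Icc 0 1) t := by
    by_cases ht : t ∈ Icc (0 : ℝ) 1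
    · have hd := (hW.smooth.differentiableOn_iteratedDerivWithin (m := n)
        (by exact_mod_cast WithTop.coe_lt_top n) (uniqueDiffOn_Icc zero_lt_one) t
        ht).hasDerivWithinAt
      rw [← iteratedDerivWithin_succ] at hd
      have he : flatExtension W (n + 1) t = iteratedDerivWithin (n + 1) W (Icc 0 1) t :=
        indicator_of_mem ht _
      rw [he]
      exact hd.congr (fun x hx => indicator_of_mem hx _) (indicator_of_mem ht _)
    · exact HasFDerivWithinAt.of_notMem_closure (by rwa [isClosed_Icc.closure_eq])
  have h2 : HasDerivWithinAt (flatExtension W n) (flatExtension W (n + 1) t) (Iic 0) t := by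
    by_cases ht : t ∈ Iic (0 : ℝ)
    · rw [hW.flatExtension_of_nonpos _ ht]
      exact (hasDerivWithinAt_const t (Iic 0) (0 : ℝ)).congr
        (fun x hx => hW.flatExtension_of_nonpos _ hx) (hW.flatExtension_of_nonpos _ ht)
    · exact HasFDerivWithinAt.of_notMem_closure (by rwa [isClosed_Iic.closure_eq])
  have h3 : HasDerivWithinAt (flatExtension W n) (flatExtension W (n + 1) t) (Ici 1) t := by
    by_cases ht : t ∈ Ici (1 : ℝ)
    · rw [hW.flatExtension_of_one_le _ ht]
      exact (hasDerivWithinAt_const t (Ici 1) (0 : ℝ)).congr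
        (fun x hx => hW.flatExtension_of_one_le _ hx) (hW.flatExtension_of_one_le _ ht)
    · exact HasFDerivWithinAt.of_notMem_closure (by rwa [isClosed_Ici.closure_eq])
  have h := (h2.union h1).union h3
  rwa [Iic_union_Icc_eq_Iic zero_le_one, Iic_union_Ici, hasDerivWithinAt_univ] at h

theorem contDiff_flatExtension (hW : IsBellCurve W) (n : ℕ) :
    ContDiff ℝ ∞ (flatExtension W n) := by
  rw [contDiff_infty]
  intro m
  induction m generalizing n with
  | zero =>
    exact contDiff_zero.2 (continuous_iff_continuousAt.2 fun t =>
      (hW.hasDerivAt_flatExtension n t).continuousAt)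
  | succ m ih =>
    rw [Nat.cast_succ, contDiff_succ_iff_deriv]
    refine ⟨fun t => (hW.hasDerivAt_flatExtension n t).differentiableAt, by simp, ?_⟩
    rw [funext fun t => (hW.hasDerivAt_flatExtension n t).deriv]
    exact ih (n + 1)

end IsBellCurve

/-- The sign `±1` attached to a letter. -/
noncomputable def letterSign (b : Bool) : ℝ := if b = true then 1 else -1

theorem bellWave_eq (W : ℝ → ℝ) (α : Bernoulli) (t : ℝ) :
    bellWave W α t = 2 + letterSign (α ⌊t⌋) * W (Int.fract t) := by
  unfold bellWave letterSign Int.fract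
  split_ifs <;> ring

theorem letterSign_injective : Function.Injective letterSign := by
  intro a b h
  cases a <;> cases b <;> simp [letterSign] at h ⊢ <;> norm_num at h

theorem abs_letterSign (b : Bool) : |letterSign b| = 1 := by
  cases b <;> simp [letterSign]

namespace IsBellCurve

variable {W : ℝ → ℝ}

theorem fract_mem_Icc (t : ℝ) : Int.fract t ∈ Icc (0 : ℝ) 1 :=
  ⟨Int.fract_nonneg t, (Int.fract_lt_one t).le⟩

/-- The two pieces of `W_α` around the integer `n`. -/
theorem bellWave_eq_of_mem_Ioo (hW : IsBellCurve W) (α : Bernoulli) (n : ℤ) {t : ℝ}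
    (ht : t ∈ Ioo (n - 1 : ℝ) (n + 1)) :
    bellWave W α t = 2 + letterSign (α (n - 1)) * flatExtension W 0 (t - (n - 1)) +
      letterSign (α n) * flatExtension W 0 (t - n) := by
  rw [bellWave_eq]
  rcases lt_or_ge t n with h | h
  · have hf : ⌊t⌋ = n - 1 := by
      rw [Int.floor_eq_iff]; push_cast; exact ⟨ht.1.le, by linarith⟩
    have hfr : Int.fract t = t - (n - 1) := by
      rw [← Int.self_sub_floor, hf]; push_cast; rfl
    rw [hW.flatExtension_of_nonpos 0 (t := t - n) (by linarith), hf, hfr,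
      flatExtension_zero_of_mem ⟨by linarith [ht.1], by linarith⟩]
    ring
  · have hf : ⌊t⌋ = n := by
      rw [Int.floor_eq_iff]; exact ⟨h, ht.2⟩
    have hfr : Int.fract t = t - n := by
      rw [← Int.self_sub_floor, hf]
    rw [hW.flatExtension_of_one_le 0 (t := t - (n - 1)) (by linarith), hf, hfr,
      flatExtension_zero_of_mem ⟨by linarith, by linarith [ht.2]⟩]
    ring

theorem bellWave_eventuallyEq (hW : IsBellCurve W) (α : Bernoulli) (n : ℤ) {t : ℝ}
    (ht : t ∈ Ioo (n - 1 : ℝ) (n + 1)) :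
    bellWave W α =ᶠ[nhds t] fun s =>
      2 + letterSign (α (n - 1)) * flatExtension W 0 (s - (n - 1)) +
      letterSign (α n) * flatExtension W 0 (s - n) := by
  filter_upwards [isOpen_Ioo.mem_nhds ht] with s hs using hW.bellWave_eq_of_mem_Ioo α n hs

theorem contDiff_bellWave (hW : IsBellCurve W) (α : Bernoulli) :
    ContDiff ℝ ∞ (bellWave W α) := by
  rw [contDiff_iff_contDiffAt]
  intro t
  have ht : t ∈ Ioo ((⌊t⌋ : ℤ) - 1 : ℝ) ((⌊t⌋ : ℤ) + 1) :=
    ⟨by linarith [Int.floor_le t], Int.lt_floor_add_one t⟩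
  refine ContDiffAt.congr_of_eventuallyEq ?_ (hW.bellWave_eventuallyEq α ⌊t⌋ ht)
  have h := hW.contDiff_flatExtension 0
  have h1 : ContDiff ℝ ∞ fun s : ℝ => flatExtension W 0 (s - ((⌊t⌋ : ℤ) - 1)) :=
    h.comp (by fun_prop)
  have h2 : ContDiff ℝ ∞ fun s : ℝ => flatExtension W 0 (s - (⌊t⌋ : ℤ)) :=
    h.comp (by fun_prop)
  exact ((contDiff_const.add (contDiff_const.mul h1)).add (contDiff_const.mul h2)).contDiffAt

/-- The origin is the seam between the letters `-1` and `0`; both bumps are flat there, which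
supplies the time where `J' = J'' = 0`. -/
theorem deriv_bellWave_eventuallyEq (hW : IsBellCurve W) (α : Bernoulli) :
    deriv (bellWave W α) =ᶠ[nhds 0] fun s =>
      letterSign (α (-1)) * flatExtension W 1 (s + 1) +
      letterSign (α 0) * flatExtension W 1 s := by
  have h0 : (0 : ℝ) ∈ Ioo (((0 : ℤ) : ℝ) - 1) (((0 : ℤ) : ℝ) + 1) := by norm_num
  filter_upwards [(hW.bellWave_eventuallyEq α 0 h0).eventuallyEq_nhds] with s hs
  rw [hs.deriv_eq]
  have h1 := (hW.hasDerivAt_flatExtension 0 (s + 1)).comp_add_const s 1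
  have h2 := hW.hasDerivAt_flatExtension 0 s
  have h := ((h1.const_mul (letterSign (α (-1)))).const_add 2).add
    (h2.const_mul (letterSign (α 0)))
  convert h.deriv using 2
  funext s
  simp

theorem deriv_bellWave_zero (hW : IsBellCurve W) (α : Bernoulli) :
    deriv (bellWave W α) 0 = 0 := by
  refine (hW.deriv_bellWave_eventuallyEq α).self_of_nhds.trans ?_
  beta_reduce
  rw [hW.flatExtension_of_one_le _ (by norm_num), hW.flatExtension_of_nonpos _ le_rfl]
  ring

theorem deriv_deriv_bellWave_zero (hW : IsBellCurve W) (α : Bernoulli) :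
    deriv (deriv (bellWave W α)) 0 = 0 := by
  rw [(hW.deriv_bellWave_eventuallyEq α).deriv_eq]
  have h1 := (hW.hasDerivAt_flatExtension 1 (0 + 1)).comp_add_const 0 1
  have h2 := hW.hasDerivAt_flatExtension 1 0
  have h := (h1.const_mul (letterSign (α (-1)))).add (h2.const_mul (letterSign (α 0)))
  refine h.deriv.trans ?_
  rw [hW.flatExtension_of_one_le _ (by norm_num), hW.flatExtension_of_nonpos _ le_rfl]
  ring

/-! ### Values of the functions `W_α` -/

theorem abs_bellWave_sub_two (hW : IsBellCurve W) (α : Bernoulli) (t : ℝ) :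
    |bellWave W α t - 2| = W (Int.fract t) := by
  rw [bellWave_eq, add_sub_cancel_left, abs_mul, abs_letterSign, one_mul,
    abs_of_nonneg (hW.mapsTo (fract_mem_Icc t)).1]

theorem one_le_bellWave (hW : IsBellCurve W) (α : Bernoulli) (t : ℝ) : 1 ≤ bellWave W α t := by
  have h1 := hW.abs_bellWave_sub_two α t
  have h2 := (hW.mapsTo (fract_mem_Icc t)).2
  linarith [neg_abs_le (bellWave W α t - 2)]

theorem bellWave_le_three (hW : IsBellCurve W) (α : Bernoulli) (t : ℝ) :
    bellWave W α t ≤ 3 := by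
  have h1 := hW.abs_bellWave_sub_two α t
  have h2 := (hW.mapsTo (fract_mem_Icc t)).2
  linarith [le_abs_self (bellWave W α t - 2)]

theorem bellWave_pos (hW : IsBellCurve W) (α : Bernoulli) (t : ℝ) : 0 < bellWave W α t :=
  zero_lt_one.trans_le (hW.one_le_bellWave α t)

theorem bellWave_zero (hW : IsBellCurve W) (α : Bernoulli) : bellWave W α 0 = 2 := by
  have h0 := hW.flat_zero 0
  rw [iteratedDerivWithin_zero] at h0
  rw [bellWave_eq, Int.fract_zero, h0]
  ring

theorem exists_peak (hW : IsBellCurve W) : ∃ p : ℝ, 0 ≤ p ∧ p < 1 ∧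
    (∀ t, W (Int.fract t) = 1 ↔ Int.fract t = p) ∧
    ∀ (α : Bernoulli) (n : ℤ), bellWave W α (n + p) = 2 + letterSign (α n) := by
  obtain ⟨p, hp, hp2, hp1, hu⟩ := hW.peak
  have hlt : p < 1 := by linarith
  refine ⟨p, hp.1, hlt, fun t => ⟨hu _ (fract_mem_Icc t), fun h => h ▸ hp1⟩, fun α n => ?_⟩
  rw [bellWave_eq, Int.fract_intCast_add, Int.fract_eq_self.2 ⟨hp.1, hlt⟩, hp1,
    Int.floor_intCast_add, Int.floor_eq_zero_iff.2 ⟨hp.1, hlt⟩, add_zero, mul_one]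

theorem bellWave_shift (α : Bernoulli) (k : ℤ) (t : ℝ) :
    bellWave W (Multiplicative.ofAdd k • α) t = bellWave W α (t - k) := by
  rw [bellWave_eq, bellWave_eq, Int.fract_sub_intCast, Int.floor_sub_intCast]
  rfl

/-- The ratio of the extrema of `W_α` determines the extrema. -/
theorem bellWave_scale_eq_one (hW : IsBellCurve W) {α β : Bernoulli} {c : ℝ} {σ : ℝ → ℝ}
    (hσ : Function.Surjective σ) (h : ∀ t, bellWave W α t = c * bellWave W β (σ t)) : c = 1 := by
  obtain ⟨p, hp0, hp1, -, hp⟩ := hW.exists_peak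
  have range_spec : ∀ γ : Bernoulli,
      ((∃ t, bellWave W γ t = 3) ∨ ∀ t, bellWave W γ t ≤ 2) ∧
      ((∃ t, bellWave W γ t = 1) ∨ ∀ t, 2 ≤ bellWave W γ t) := by
    intro γ
    constructor
    · by_cases hγ : ∃ n, γ n = true
      · obtain ⟨n, hn⟩ := hγ
        exact Or.inl ⟨n + p, by rw [hp, hn, letterSign, if_pos rfl]; norm_num⟩
      · push Not at hγ
        refine Or.inr fun t => ?_
        rw [bellWave_eq, letterSign, if_neg (hγ _)]
        linarith [(hW.mapsTo (fract_mem_Icc t)).1]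
    · by_cases hγ : ∃ n, γ n ≠ true
      · obtain ⟨n, hn⟩ := hγ
        exact Or.inl ⟨n + p, by rw [hp, letterSign, if_neg hn]; norm_num⟩
      · push Not at hγ
        refine Or.inr fun t => ?_
        rw [bellWave_eq, letterSign, if_pos (hγ _)]
        linarith [(hW.mapsTo (fract_mem_Icc t)).1]
  have nonconst : ∀ γ : Bernoulli, (∃ t, bellWave W γ t = 3) ∨ ∃ t, bellWave W γ t = 1 := by
    intro γ
    cases hγ : γ 0
    · exact Or.inr ⟨(0 : ℤ) + p, by rw [hp, hγ, letterSign, if_neg (by simp)]; norm_num⟩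
    · exact Or.inl ⟨(0 : ℤ) + p, by rw [hp, hγ, letterSign, if_pos rfl]; norm_num⟩
  have hmax : ∀ γ : Bernoulli, ∃ M, ((∃ t, bellWave W γ t = M) ∧ ∀ t, bellWave W γ t ≤ M) ∧
      ∃ m, ((∃ t, bellWave W γ t = m) ∧ ∀ t, m ≤ bellWave W γ t) ∧
        (M = 3 ∧ m = 1 ∨ M = 3 ∧ m = 2 ∨ M = 2 ∧ m = 1) := by
    intro γ
    have h0 : ∃ t, bellWave W γ t = 2 := ⟨0, hW.bellWave_zero γ⟩
    obtain ⟨h1 | h1, h2 | h2⟩ := range_spec γ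
    · exact ⟨3, ⟨h1, hW.bellWave_le_three γ⟩, 1, ⟨h2, hW.one_le_bellWave γ⟩, by norm_num⟩
    · exact ⟨3, ⟨h1, hW.bellWave_le_three γ⟩, 2, ⟨h0, h2⟩, by norm_num⟩
    · exact ⟨2, ⟨h0, h1⟩, 1, ⟨h2, hW.one_le_bellWave γ⟩, by norm_num⟩
    · exfalso
      rcases nonconst γ with ⟨t, ht⟩ | ⟨t, ht⟩
      · linarith [h1 t]
      · linarith [h2 t]
  have hc : 0 < c := by
    have := h 0
    rw [hW.bellWave_zero] at this
    exact pos_of_mul_pos_left (by rw [← this]; norm_num) (hW.bellWave_pos β _).le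
  obtain ⟨M, ⟨⟨t1, ht1⟩, hM⟩, m, ⟨⟨t2, ht2⟩, hm⟩, hMm⟩ := hmax α
  obtain ⟨M', ⟨⟨s1, hs1⟩, hM'⟩, m', ⟨⟨s2, hs2⟩, hm'⟩, hMm'⟩ := hmax β
  obtain ⟨u1, rfl⟩ := hσ s1
  obtain ⟨u2, rfl⟩ := hσ s2
  have e1 : M = c * M' := le_antisymm
    (by rw [← ht1, h]; exact mul_le_mul_of_nonneg_left (hM' _) hc.le)
    (by rw [← hs1, ← h]; exact hM _)
  have e2 : m = c * m' := le_antisymm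
    (by rw [← hs2, ← h]; exact hm _)
    (by rw [← ht2, h]; exact mul_le_mul_of_nonneg_left (hm' _) hc.le)
  -- The possible ratios of maximum to minimum are `3`, `3/2` and `2`. They are distinct, so both
  -- functions have the same extrema, unless the two equations for `c` conflict.
  rcases hMm with ⟨rfl, rfl⟩ | ⟨rfl, rfl⟩ | ⟨rfl, rfl⟩ <;>
    rcases hMm' with ⟨rfl, rfl⟩ | ⟨rfl, rfl⟩ | ⟨rfl, rfl⟩ <;> linarith

/-- Affine isometries of the line carrying one `W_β` to a multiple of `W_α` are integer shifts. -/
theorem exists_shift_of_bellWave_eq (hW : IsBellCurve W) {α β : Bernoulli} {c ε s : ℝ}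
    (hε : ε = 1 ∨ ε = -1) (h : ∀ t, bellWave W α t = c * bellWave W β (ε * t + s)) :
    ∃ k : ℤ, (∀ t, ε * t + s = t - k) ∧ ∀ n : ℤ, α n = β (n - k) := by
  have hσ : Function.Surjective fun t : ℝ => ε * t + s := fun y => by
    rcases hε with rfl | rfl
    · exact ⟨y - s, by ring⟩
    · exact ⟨s - y, by ring⟩
  have hc := hW.bellWave_scale_eq_one hσ h
  subst hc
  simp only [one_mul] at h
  have hfr : ∀ t, W (Int.fract (ε * t + s)) = W (Int.fract t) := fun t => by
    rw [← hW.abs_bellWave_sub_two α t, ← hW.abs_bellWave_sub_two β, h]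
  rcases hε with rfl | rfl
  · obtain ⟨p, hp0, hp1, hpu, hp⟩ := hW.exists_peak
    have hpf : Int.fract p = p := Int.fract_eq_self.2 ⟨hp0, hp1⟩
    have h1 := hfr p
    -- The translate of the peak is again a peak, so `p + s` has fractional part `p`.
    rw [(hpu p).2 hpf, hpu, one_mul] at h1
    have hs : s = ⌊p + s⌋ := by
      have := Int.floor_add_fract (p + s)
      linarith
    refine ⟨-⌊p + s⌋, fun t => ?_, fun n => ?_⟩
    · push_cast
      rw [← hs]
      ring
    · apply letterSign_injective
      have h2 := h (n + p)
      have h3 := hp β (n - -⌊p + s⌋)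
      push_cast at h3
      rw [← hs] at h3
      rw [hp, show 1 * ((n : ℝ) + p) + s = n - -s + p by ring, h3] at h2
      linarith
  -- The map `t ↦ s - t` is the reflection about `s / 2`.
  · refine absurd ⟨s / 2, fun t => ?_⟩ hW.asymmetric
    rw [← hfr t]
    congr 2
    ring

end IsBellCurve

/-! ### The Hubble function of a scale factor -/

/-- The logarithmic derivative `a' / a` of `a = √J`. -/
noncomputable def hubble (J : ℝ → ℝ) (t : ℝ) : ℝ := deriv J t / (2 * J t)

/-- The curvature function `a'' / a` of `a = √J`. -/
noncomputable def acceleration (J : ℝ → ℝ) (t : ℝ) : ℝ := deriv (hubble J) t + hubble J t ^ 2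

section Hubble

variable {J : ℝ → ℝ}

theorem contDiff_deriv_of_contDiff_infty {f : ℝ → ℝ} (hf : ContDiff ℝ ∞ f) :
    ContDiff ℝ ∞ (deriv f) :=
  (contDiff_infty_iff_deriv.1 hf).2

theorem contDiff_hubble (hJ : ContDiff ℝ ∞ J) (hpos : ∀ t, 0 < J t) :
    ContDiff ℝ ∞ (hubble J) :=
  (contDiff_deriv_of_contDiff_infty hJ).div (contDiff_const.mul hJ)
    fun t => (mul_pos two_pos (hpos t)).ne'

theorem hasDerivAt_hubble (hJ : ContDiff ℝ ∞ J) (hpos : ∀ t, 0 < J t) (t : ℝ) :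
    HasDerivAt (hubble J) (deriv (hubble J) t) t :=
  ((contDiff_hubble hJ hpos).differentiable (by simp) t).hasDerivAt

theorem contDiff_acceleration (hJ : ContDiff ℝ ∞ J) (hpos : ∀ t, 0 < J t) :
    ContDiff ℝ ∞ (acceleration J) :=
  (contDiff_deriv_of_contDiff_infty (contDiff_hubble hJ hpos)).add
    ((contDiff_hubble hJ hpos).pow 2)

theorem hasDerivAt_scale (hJ : ContDiff ℝ ∞ J) (hpos : ∀ t, 0 < J t) (t : ℝ) :
    HasDerivAt J (2 * hubble J t * J t) t := by
  have h : 2 * hubble J t * J t = deriv J t := by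
    have := (hpos t).ne'
    rw [hubble]
    field_simp
  rw [h]
  exact (hJ.differentiable (by simp) t).hasDerivAt

theorem acceleration_eq_zero_of_flat (hJ : ContDiff ℝ ∞ J) (hpos : ∀ t, 0 < J t) {t : ℝ}
    (h1 : deriv J t = 0) (h2 : deriv (deriv J) t = 0) : acceleration J t = 0 := by
  have hd := ((contDiff_deriv_of_contDiff_infty hJ).differentiable (by simp) t).hasDerivAt
  have hd' := (hJ.differentiable (by simp) t).hasDerivAt.const_mul 2
  have h := (hd.div hd' (mul_pos two_pos (hpos t)).ne').deriv
  have h' : deriv (hubble J) t = _ := h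
  rw [acceleration, h', hubble, h1, h2]
  simp

/-- With `a = √J`, the quantity `J * hubble J ^ 2` is `(a')²`. It is constant because `a'' = 0`, and
it vanishes at `t₀`. -/
theorem eq_of_acceleration_eq_zero (hJ : ContDiff ℝ ∞ J) (hpos : ∀ t, 0 < J t) {t₀ : ℝ}
    (h0 : deriv J t₀ = 0) (h : ∀ t, acceleration J t = 0) (a b : ℝ) : J a = J b := by
  have hm : ∀ t, HasDerivAt (fun t => J t * hubble J t ^ 2) 0 t := fun t => by
    refine ((hasDerivAt_scale hJ hpos t).mul ((hasDerivAt_hubble hJ hpos t).pow 2)).congr_deriv ?_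
    have := h t
    rw [acceleration] at this
    simp only [Nat.cast_ofNat, Pi.pow_apply]
    linear_combination 2 * J t * hubble J t * this
  have hz : ∀ t, hubble J t = 0 := fun t => by
    have h1 := is_const_of_deriv_eq_zero (fun t => (hm t).differentiableAt)
      (fun t => (hm t).deriv) t t₀
    have h2 : hubble J t₀ = 0 := by rw [hubble, h0, zero_div]
    simp only [h2] at h1
    simpa [(hpos t).ne'] using h1
  have hd : ∀ t, HasDerivAt J 0 t := fun t => by
    simpa [hz t] using hasDerivAt_scale hJ hpos t
  exact is_const_of_deriv_eq_zero (fun t => (hd t).differentiableAt) (fun t => (hd t).deriv) a b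

end Hubble

/-! ### Derivatives along lines -/

section Lines

variable {E F : Type*} [NormedAddCommGroup E] [NormedSpace ℝ E] [NormedAddCommGroup F]
  [NormedSpace ℝ F]

theorem hasDerivAt_comp_line {f : E → F} {x u : E} {t : ℝ}
    (hf : DifferentiableAt ℝ f (x + t • u)) :
    HasDerivAt (fun s : ℝ => f (x + s • u)) (fderiv ℝ f (x + t • u) u) t := by
  have h : HasDerivAt (fun s : ℝ => x + s • u) u t := by
    simpa using ((hasDerivAt_id t).smul_const u).const_add x
  exact hf.hasFDerivAt.comp_hasDerivAt t h

theorem hasDerivAt_comp_line_zero {f : E → F} {x : E} (u : E) (hf : DifferentiableAt ℝ f x) :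
    HasDerivAt (fun s : ℝ => f (x + s • u)) (fderiv ℝ f x u) 0 := by
  have h := hasDerivAt_comp_line (f := f) (x := x) (u := u) (t := 0) (by simpa using hf)
  simpa using h

theorem two_le_infty : (2 : WithTop ℕ∞) ≤ ∞ :=
  WithTop.coe_le_coe.2 (le_top : (2 : ℕ∞) ≤ ⊤)

theorem fderiv_fderiv_comm {f : E → F} (hf : ContDiff ℝ ∞ f) (x u v : E) :
    fderiv ℝ (fun y => fderiv ℝ f y v) x u = fderiv ℝ (fun y => fderiv ℝ f y u) x v := by
  have hd : DifferentiableAt ℝ (fderiv ℝ f) x :=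
    (hf.fderiv_right (m := ∞) (by simp)).differentiable (by simp) x
  have h : ∀ w, fderiv ℝ (fun y => fderiv ℝ f y w) x = (fderiv ℝ (fderiv ℝ f) x).flip w :=
    fun w => by
      rw [fderiv_clm_apply hd (differentiableAt_const w)]
      simp
  rw [h, h]
  exact (hf.contDiffAt.isSymmSndFDerivAt (by simpa using two_le_infty)) u v

theorem contDiff_fderiv_apply_const {f : E → F} (hf : ContDiff ℝ ∞ f) (v : E) :
    ContDiff ℝ ∞ fun y => fderiv ℝ f y v :=
  (hf.fderiv_right (m := ∞) (by simp)).clm_apply contDiff_const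

end Lines

/-! ### Isometries of Robertson-Walker metrics -/

/-- The coordinate vector `∂/∂t`. -/
noncomputable abbrev timeVec (d : ℕ) : Coord d := EuclideanSpace.single 0 1

/-- The coordinate vector `∂/∂xⁱ`. -/
noncomputable abbrev spaceVec {d : ℕ} (i : Fin d) : Coord d := EuclideanSpace.single i.succ 1

/-- The Euclidean product of the spatial parts. -/
def spatialDot {d : ℕ} (v w : Coord d) : ℝ := ∑ i : Fin d, v i.succ * w i.succ

section SpatialDot

variable {d : ℕ}

theorem spatialDot_comm (v w : Coord d) : spatialDot v w = spatialDot w v :=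
  Finset.sum_congr rfl fun _ _ => mul_comm _ _

@[simp] theorem spatialDot_timeVec_right (v : Coord d) : spatialDot v (timeVec d) = 0 :=
  Finset.sum_eq_zero fun i _ => by simp [Fin.succ_ne_zero]

@[simp] theorem spatialDot_timeVec_left (v : Coord d) : spatialDot (timeVec d) v = 0 := by
  rw [spatialDot_comm, spatialDot_timeVec_right]

@[simp] theorem spatialDot_spaceVec_right (v : Coord d) (i : Fin d) :
    spatialDot v (spaceVec i) = v i.succ := by
  simp [spatialDot]

theorem spatialDot_self_nonneg (v : Coord d) : 0 ≤ spatialDot v v :=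
  Finset.sum_nonneg fun _ _ => mul_self_nonneg _

@[simp] theorem spaceVec_zero (i : Fin d) : (spaceVec i : Coord d) 0 = 0 := by
  simp [(Fin.succ_ne_zero i).symm]

@[simp] theorem timeVec_zero : (timeVec d) 0 = 1 := by simp

end SpatialDot

/-- `φ` carries `-dt² + J dx²` to `-dt² + K dx²`, and `Dφ` hits `∂/∂t` everywhere. -/
structure IsRWIsometry {d : ℕ} (J K : ℝ → ℝ) (φ : Coord d → Coord d) : Prop where
  contDiff : ContDiff ℝ ∞ φ
  source_smooth : ContDiff ℝ ∞ J
  source_pos : ∀ t, 0 < J t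
  target_smooth : ContDiff ℝ ∞ K
  target_pos : ∀ t, 0 < K t
  pullback : ∀ x v w : Coord d, -(v 0 * w 0) + J (x 0) * spatialDot v w =
    -(fderiv ℝ φ x v 0 * fderiv ℝ φ x w 0) +
      K (φ x 0) * spatialDot (fderiv ℝ φ x v) (fderiv ℝ φ x w)
  exists_time : ∀ x, ∃ w, fderiv ℝ φ x w = timeVec d

namespace IsRWIsometry

variable {d : ℕ} {J K : ℝ → ℝ} {φ : Coord d → Coord d}

theorem contDiff_time (h : IsRWIsometry J K φ) : ContDiff ℝ ∞ fun x => φ x 0 :=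
  (contDiff_euclidean.1 h.contDiff) 0

theorem fderiv_time (h : IsRWIsometry J K φ) (x v : Coord d) :
    fderiv ℝ (fun x => φ x 0) x v = fderiv ℝ φ x v 0 := by
  have h1 := (EuclideanSpace.proj (𝕜 := ℝ) (0 : Fin (d + 1))).hasFDerivAt.comp x
    (h.contDiff.differentiable (by simp) x).hasFDerivAt
  have h2 : fderiv ℝ (fun x => φ x 0) x = _ := h1.fderiv
  rw [h2]
  rfl

theorem hasDerivAt_coord_line (x u : Coord d) (j : Fin (d + 1)) (t : ℝ) :
    HasDerivAt (fun s : ℝ => (x + s • u) j) (u j) t := by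
  simpa using ((hasDerivAt_id t).mul_const (u j)).const_add (x j)

/-- The derivative of the pullback equation along `u`. -/
theorem deriv_pullback (h : IsRWIsometry J K φ) (x u v w : Coord d) :
    2 * hubble J (x 0) * J (x 0) * u 0 * spatialDot v w =
      -(fderiv ℝ (fderiv ℝ φ) x u v 0 * fderiv ℝ φ x w 0 +
        fderiv ℝ φ x v 0 * fderiv ℝ (fderiv ℝ φ) x u w 0) +
      (2 * hubble K (φ x 0) * K (φ x 0) * fderiv ℝ φ x u 0 *
        spatialDot (fderiv ℝ φ x v) (fderiv ℝ φ x w) +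
      K (φ x 0) * (spatialDot (fderiv ℝ (fderiv ℝ φ) x u v) (fderiv ℝ φ x w) +
        spatialDot (fderiv ℝ φ x v) (fderiv ℝ (fderiv ℝ φ) x u w))) := by
  have hA : DifferentiableAt ℝ (fderiv ℝ φ) x :=
    (h.contDiff.fderiv_right (m := ∞) (by simp)).differentiable (by simp) x
  have hD : ∀ (z : Coord d) (j : Fin (d + 1)),
      HasDerivAt (fun s : ℝ => fderiv ℝ φ (x + s • u) z j)
        (fderiv ℝ (fderiv ℝ φ) x u z j) 0 := fun z j => by
    have h1 := (hasDerivAt_comp_line_zero u hA).clm_apply (hasDerivAt_const (0 : ℝ) z)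
    have h2 := (EuclideanSpace.proj (𝕜 := ℝ) j).hasFDerivAt.comp_hasDerivAt (0 : ℝ) h1
    simpa [Function.comp_def] using h2
  have hφ : HasDerivAt (fun s : ℝ => φ (x + s • u) 0) (fderiv ℝ φ x u 0) 0 := by
    rw [← h.fderiv_time]
    exact hasDerivAt_comp_line_zero u (h.contDiff_time.differentiable (by simp) x)
  have hK : HasDerivAt (fun s : ℝ => K (φ (x + s • u) 0))
      (2 * hubble K (φ x 0) * K (φ x 0) * fderiv ℝ φ x u 0) 0 :=
    HasDerivAt.comp (0 : ℝ) (h₂ := K)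
      (by simpa using hasDerivAt_scale h.target_smooth h.target_pos (φ x 0)) hφ
  have hJ : HasDerivAt (fun s : ℝ => J ((x + s • u) 0))
      (2 * hubble J (x 0) * J (x 0) * u 0) 0 :=
    HasDerivAt.comp (0 : ℝ) (h₂ := J)
      (by simpa using hasDerivAt_scale h.source_smooth h.source_pos (x 0))
      (hasDerivAt_coord_line x u 0 0)
  have hS : HasDerivAt (fun s : ℝ =>
      spatialDot (fderiv ℝ φ (x + s • u) v) (fderiv ℝ φ (x + s • u) w))
      (spatialDot (fderiv ℝ (fderiv ℝ φ) x u v) (fderiv ℝ φ x w) +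
        spatialDot (fderiv ℝ φ x v) (fderiv ℝ (fderiv ℝ φ) x u w)) 0 := by
    have h1 := HasDerivAt.fun_sum (u := Finset.univ) fun (i : Fin d) _ =>
      (hD v i.succ).mul (hD w i.succ)
    refine h1.congr_deriv ?_
    simp [spatialDot, Finset.sum_add_distrib]
  have hL := (hJ.mul_const (spatialDot v w)).const_add (-(v 0 * w 0))
  have hR := ((hD v 0).mul (hD w 0)).neg.add (hK.mul hS)
  have heq := hL.unique (hR.congr_of_eventuallyEq
    (Filter.Eventually.of_forall fun s => h.pullback (x + s • u) v w))
  simpa using heq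

/-- The Hessian of the time component of an isometry. -/
theorem hessian_time (h : IsRWIsometry J K φ) (x u v : Coord d) :
    fderiv ℝ (fun y => fderiv ℝ (fun x => φ x 0) y v) x u =
      -hubble K (φ x 0) * (-(u 0 * v 0) + J (x 0) * spatialDot u v +
        fderiv ℝ (fun x => φ x 0) x u * fderiv ℝ (fun x => φ x 0) x v) -
      hubble J (x 0) * (
        u 0 * (v 0 * fderiv ℝ (fun x => φ x 0) x (timeVec d) - fderiv ℝ (fun x => φ x 0) x v) +
        v 0 * (u 0 * fderiv ℝ (fun x => φ x 0) x (timeVec d) - fderiv ℝ (fun x => φ x 0) x u) -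
        J (x 0) * fderiv ℝ (fun x => φ x 0) x (timeVec d) * spatialDot u v) := by
  have hA : DifferentiableAt ℝ (fderiv ℝ φ) x :=
    (h.contDiff.fderiv_right (m := ∞) (by simp)).differentiable (by simp) x
  have hsymm : ∀ a b, fderiv ℝ (fderiv ℝ φ) x a b = fderiv ℝ (fderiv ℝ φ) x b a :=
    fun a b => h.contDiff.contDiffAt.isSymmSndFDerivAt (by simpa using two_le_infty) a b
  have hD : fderiv ℝ (fun y => fderiv ℝ (fun x => φ x 0) y v) x u =
      fderiv ℝ (fderiv ℝ φ) x u v 0 := by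
    simp only [h.fderiv_time]
    have h1 := (hasDerivAt_comp_line_zero u hA).clm_apply (hasDerivAt_const (0 : ℝ) v)
    have h2 := (EuclideanSpace.proj (𝕜 := ℝ) (0 : Fin (d + 1))).hasFDerivAt.comp_hasDerivAt
      (0 : ℝ) h1
    have h3 := hasDerivAt_comp_line_zero (f := fun y => fderiv ℝ φ y v 0) u
      ((((contDiff_euclidean.1 (contDiff_fderiv_apply_const h.contDiff v)) 0).differentiable
        (by simp)) x)
    simpa using h3.unique h2
  rw [hD]
  simp only [h.fderiv_time]
  -- Pairing with `∂/∂t = Dφ w` in the target extracts minus the time component.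
  obtain ⟨w, hw⟩ := h.exists_time x
  have p1 := h.deriv_pullback x u v w
  have p2 := h.deriv_pullback x v u w
  have p3 := h.deriv_pullback x w u v
  have q1 := h.pullback x u v
  have q2 := h.pullback x u w
  have q3 := h.pullback x v w
  have q4 := h.pullback x (timeVec d) w
  rw [hw] at p1 p2 p3 q2 q3 q4
  rw [hsymm v u] at p2
  rw [hsymm w u, hsymm w v, spatialDot_comm (fderiv ℝ (fderiv ℝ φ) x u w)] at p3
  simp only [timeVec_zero, spatialDot_timeVec_right, spatialDot_timeVec_left] at p1 p2 p3 q2 q3 q4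
  -- Koszul's polarization: `p1 + p2 - p3` isolates the second derivative in `u, v`. The
  -- undifferentiated equations `q1`–`q4` then eliminate `w` and the spatial part of `Dφ`.
  linear_combination (p1 + p2 - p3) / 2 + hubble K (φ x 0) * q1 - hubble J (x 0) * u 0 * q3 -
    hubble J (x 0) * v 0 * q2 +
    hubble J (x 0) * (2 * u 0 * v 0 - J (x 0) * spatialDot u v) * q4

end IsRWIsometry

/-! ### First-order constraints, the Hessian system and the curvature invariant -/

namespace IsRWIsometry

variable {d : ℕ} {J K : ℝ → ℝ} {φ : Coord d → Coord d}

/-- The preimage `w` of `∂/∂t` has squared length `-1` and time component `∂ₜT`, so `(∂ₜT)²` is `1`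
plus its spatial square length. -/
theorem one_le_sq_deriv_time (h : IsRWIsometry J K φ) (x : Coord d) :
    1 ≤ fderiv ℝ (fun x => φ x 0) x (timeVec d) ^ 2 := by
  obtain ⟨w, hw⟩ := h.exists_time x
  have q1 := h.pullback x (timeVec d) w
  have q2 := h.pullback x w w
  rw [h.fderiv_time]
  rw [hw] at q1 q2
  simp only [timeVec_zero, spatialDot_timeVec_right, spatialDot_timeVec_left] at q1 q2
  have hS := mul_nonneg (h.source_pos (x 0)).le (spatialDot_self_nonneg w)
  have hw0 : fderiv ℝ φ x (timeVec d) 0 = w 0 := by linear_combination q1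
  rw [hw0]
  linarith

theorem sq_deriv_time_eq_one (h : IsRWIsometry J K φ) {x : Coord d}
    (hx : ∀ i : Fin d, fderiv ℝ (fun x => φ x 0) x (spaceVec i) = 0) :
    fderiv ℝ (fun x => φ x 0) x (timeVec d) ^ 2 = 1 := by
  obtain ⟨w, hw⟩ := h.exists_time x
  have q1 := h.pullback x (timeVec d) w
  have q2 := h.pullback x w w
  have hi : ∀ i : Fin d, w i.succ = 0 := fun i => by
    have q3 := h.pullback x w (spaceVec i)
    have hxi := hx i
    rw [h.fderiv_time] at hxi
    rw [hw, hxi] at q3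
    simpa [(h.source_pos (x 0)).ne'] using q3
  have hS : spatialDot w w = 0 := Finset.sum_eq_zero fun i _ => by rw [hi, mul_zero]
  rw [h.fderiv_time]
  rw [hw] at q1 q2
  simp only [timeVec_zero, spatialDot_timeVec_right, spatialDot_timeVec_left, hS] at q1 q2
  have hw0 : fderiv ℝ φ x (timeVec d) 0 = w 0 := by linear_combination q1
  rw [hw0]
  linear_combination -q2

/-! #### The Hessian in coordinate directions -/

theorem hessian_time_time (h : IsRWIsometry J K φ) (x : Coord d) :
    fderiv ℝ (fun y => fderiv ℝ (fun x => φ x 0) y (timeVec d)) x (timeVec d) =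
      hubble K (φ x 0) * (1 - fderiv ℝ (fun x => φ x 0) x (timeVec d) ^ 2) := by
  rw [h.hessian_time]
  simp only [timeVec_zero, spatialDot_timeVec_right]
  ring

theorem hessian_time_space (h : IsRWIsometry J K φ) (x : Coord d) (i : Fin d) :
    fderiv ℝ (fun y => fderiv ℝ (fun x => φ x 0) y (spaceVec i)) x (timeVec d) =
      (hubble J (x 0) - hubble K (φ x 0) * fderiv ℝ (fun x => φ x 0) x (timeVec d)) *
        fderiv ℝ (fun x => φ x 0) x (spaceVec i) := by
  rw [h.hessian_time]
  simp only [timeVec_zero, spatialDot_timeVec_left, spaceVec_zero]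
  ring

theorem hessian_space_time (h : IsRWIsometry J K φ) (x : Coord d) (i : Fin d) :
    fderiv ℝ (fun y => fderiv ℝ (fun x => φ x 0) y (timeVec d)) x (spaceVec i) =
      (hubble J (x 0) - hubble K (φ x 0) * fderiv ℝ (fun x => φ x 0) x (timeVec d)) *
        fderiv ℝ (fun x => φ x 0) x (spaceVec i) := by
  rw [fderiv_fderiv_comm h.contDiff_time, h.hessian_time_space]

theorem hessian_space_space (h : IsRWIsometry J K φ) (x : Coord d) (i : Fin d) :
    fderiv ℝ (fun y => fderiv ℝ (fun x => φ x 0) y (spaceVec i)) x (spaceVec i) =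
      J (x 0) * (hubble J (x 0) * fderiv ℝ (fun x => φ x 0) x (timeVec d) - hubble K (φ x 0)) -
        hubble K (φ x 0) * fderiv ℝ (fun x => φ x 0) x (spaceVec i) ^ 2 := by
  have hS : spatialDot (spaceVec i) (spaceVec i) = 1 := by
    rw [spatialDot_spaceVec_right]; simp
  rw [h.hessian_time, hS]
  simp only [spaceVec_zero]
  ring

theorem hasDerivAt_comp_time (h : IsRWIsometry J K φ) {f : ℝ → ℝ} {f' : ℝ} {x : Coord d}
    (hf : HasDerivAt f f' (φ x 0)) (u : Coord d) :
    HasDerivAt (fun s : ℝ => f (φ (x + s • u) 0)) (f' * fderiv ℝ (fun x => φ x 0) x u) 0 :=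
  HasDerivAt.comp (0 : ℝ) (h₂ := f) (by simpa using hf)
    (hasDerivAt_comp_line_zero u (h.contDiff_time.differentiable (by simp) x))

theorem hasDerivAt_comp_coord {f : ℝ → ℝ} {f' : ℝ} {x : Coord d}
    (hf : HasDerivAt f f' (x 0)) (u : Coord d) :
    HasDerivAt (fun s : ℝ => f ((x + s • u) 0)) (f' * u 0) 0 :=
  HasDerivAt.comp (0 : ℝ) (h₂ := f) (by simpa using hf) (hasDerivAt_coord_line x u 0 0)

theorem hasDerivAt_partial_line (h : IsRWIsometry J K φ) (x u v : Coord d) :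
    HasDerivAt (fun s : ℝ => fderiv ℝ (fun x => φ x 0) (x + s • u) v)
      (fderiv ℝ (fun y => fderiv ℝ (fun x => φ x 0) y v) x u) 0 :=
  hasDerivAt_comp_line_zero u
    ((contDiff_fderiv_apply_const h.contDiff_time v).differentiable (by simp) x)

/-- Isometries preserve the curvature function `a'' / a`. -/
theorem acceleration_eq (h : IsRWIsometry J K φ) (i : Fin d) (x : Coord d) :
    acceleration J (x 0) = acceleration K (φ x 0) := by
  have hH := hasDerivAt_hubble h.source_smooth h.source_pos (x 0)
  have hJ := hasDerivAt_scale h.source_smooth h.source_pos (x 0)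
  have hL := hasDerivAt_hubble h.target_smooth h.target_pos (φ x 0)
  have hQ := contDiff_fderiv_apply_const h.contDiff_time (spaceVec i)
  have e1 : HasDerivAt (fun s : ℝ => fderiv ℝ
      (fun y => fderiv ℝ (fun x => φ x 0) y (spaceVec i)) (x + s • timeVec d) (spaceVec i)) _ 0 :=
    hasDerivAt_comp_line_zero (timeVec d)
      ((contDiff_fderiv_apply_const hQ (spaceVec i)).differentiable (by simp) x)
  have e2 : HasDerivAt (fun s : ℝ => fderiv ℝ
      (fun y => fderiv ℝ (fun x => φ x 0) y (spaceVec i)) (x + s • spaceVec i) (timeVec d)) _ 0 :=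
    hasDerivAt_comp_line_zero (spaceVec i)
      ((contDiff_fderiv_apply_const hQ (timeVec d)).differentiable (by simp) x)
  simp only [h.hessian_space_space] at e1
  simp only [h.hessian_time_space] at e2
  have f1 := ((hasDerivAt_comp_coord hJ (timeVec d)).mul
    (((hasDerivAt_comp_coord hH (timeVec d)).mul
      (h.hasDerivAt_partial_line x (timeVec d) (timeVec d))).sub
      (h.hasDerivAt_comp_time hL (timeVec d)))).sub
    ((h.hasDerivAt_comp_time hL (timeVec d)).mul
      ((h.hasDerivAt_partial_line x (timeVec d) (spaceVec i)).pow 2))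
  have f2 := ((hasDerivAt_comp_coord hH (spaceVec i)).sub
    ((h.hasDerivAt_comp_time hL (spaceVec i)).mul
      (h.hasDerivAt_partial_line x (spaceVec i) (timeVec d)))).mul
    (h.hasDerivAt_partial_line x (spaceVec i) (spaceVec i))
  have g1 := e1.unique f1
  have g2 := e2.unique f2
  -- Integrability: `∂ₜ∂ᵢ` and `∂ᵢ∂ₜ` agree on `∂ᵢT`. After substituting the Hessian, everything
  -- cancels except `∂ₜT · J` times the difference of the two curvature functions.
  have hcomm := fderiv_fderiv_comm hQ x (timeVec d) (spaceVec i)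
  simp only [h.hessian_space_space, h.hessian_time_space] at hcomm
  have g := (g1.symm.trans hcomm).trans g2
  simp only [h.hessian_time_time, h.hessian_space_time, h.hessian_space_space,
    h.hessian_time_space, zero_smul, add_zero, timeVec_zero, spaceVec_zero, Pi.mul_apply,
    Pi.pow_apply, Pi.sub_apply, Nat.cast_ofNat] at g
  have hne : fderiv ℝ (fun x => φ x 0) x (timeVec d) * J (x 0) ≠ 0 := by
    refine mul_ne_zero (fun h0 => ?_) (h.source_pos _).ne'
    have := h.one_le_sq_deriv_time x
    rw [h0] at this
    norm_num at this
  refine mul_left_cancel₀ hne ?_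
  unfold acceleration
  linear_combination g

end IsRWIsometry

/-! ### Rigidity of the time component -/

namespace IsRWIsometry

variable {d : ℕ} {J K : ℝ → ℝ} {φ : Coord d → Coord d}

/-- The quantity `K(T) (∂ᵢT)² / J` is constant along the lines of `∂/∂t`. -/
theorem momentum_eq (h : IsRWIsometry J K φ) (i : Fin d) (x : Coord d) (t : ℝ) :
    K (φ (x + t • timeVec d) 0) *
        fderiv ℝ (fun x => φ x 0) (x + t • timeVec d) (spaceVec i) ^ 2 /
        J ((x + t • timeVec d) 0) =
      K (φ x 0) * fderiv ℝ (fun x => φ x 0) x (spaceVec i) ^ 2 / J (x 0) := by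
  have hline : ∀ y : Coord d, HasDerivAt (fun s : ℝ => K (φ (y + s • timeVec d) 0) *
      fderiv ℝ (fun x => φ x 0) (y + s • timeVec d) (spaceVec i) ^ 2 /
      J ((y + s • timeVec d) 0)) 0 0 := fun y => by
    have hJ := hasDerivAt_comp_coord
      (hasDerivAt_scale h.source_smooth h.source_pos (y 0)) (timeVec d)
    have hK := h.hasDerivAt_comp_time
      (hasDerivAt_scale h.target_smooth h.target_pos (φ y 0)) (timeVec d)
    have hQ := (h.hasDerivAt_partial_line y (timeVec d) (spaceVec i)).pow 2
    have hne := (h.source_pos (y 0)).ne'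
    refine ((hK.mul hQ).div hJ (h.source_pos _).ne').congr_deriv ?_
    simp only [h.hessian_time_space, zero_smul, add_zero, timeVec_zero, Pi.mul_apply,
      Pi.pow_apply, Nat.cast_ofNat]
    -- The logarithmic derivative is `2L ∂ₜT + 2(H - L ∂ₜT) - 2H = 0`.
    rw [div_eq_zero_iff]
    left
    ring
  have hall : ∀ t : ℝ, HasDerivAt (fun s : ℝ => K (φ (x + s • timeVec d) 0) *
      fderiv ℝ (fun x => φ x 0) (x + s • timeVec d) (spaceVec i) ^ 2 /
      J ((x + s • timeVec d) 0)) 0 t := fun t => by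
    have h1 := hline (x + t • timeVec d)
    have h2 := HasDerivAt.comp_sub_const t t (by rwa [sub_self])
    refine h2.congr_of_eventuallyEq (Filter.Eventually.of_forall fun s => ?_)
    have : x + t • timeVec d + (s - t) • timeVec d = x + s • timeVec d := by module
    simp only [this]
  have := is_const_of_deriv_eq_zero (fun t => (hall t).differentiableAt)
    (fun t => (hall t).deriv) t 0
  simpa using this

/-- If the time component of an isometry depends on space, the curvature function `a'' / a` is
constant. -/
theorem deriv_acceleration_eq_zero (h : IsRWIsometry J K φ) {i : Fin d} {x : Coord d}
    (hx : fderiv ℝ (fun x => φ x 0) x (spaceVec i) ≠ 0) (t : ℝ) :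
    deriv (acceleration J) t = 0 := by
  set y := x + (t - x 0) • timeVec d with hy
  have hy0 : y 0 = t := by simp [hy]
  -- The conserved quantity carries `∂ᵢT ≠ 0` from `x` to the point of its `t`-line at time `t`.
  have hQ : fderiv ℝ (fun x => φ x 0) y (spaceVec i) ≠ 0 := fun h0 => by
    have hm := h.momentum_eq i x (t - x 0)
    rw [← hy, h0] at hm
    have := div_pos (mul_pos (h.target_pos (φ x 0)) (pow_pos (abs_pos.2 hx) 2))
      (h.source_pos (x 0))
    rw [sq_abs, ← hm] at this
    simp at this
  have hJ := ((contDiff_acceleration h.source_smooth h.source_pos).differentiable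
    (by simp) (y 0)).hasDerivAt
  have hK := ((contDiff_acceleration h.target_smooth h.target_pos).differentiable
    (by simp) (φ y 0)).hasDerivAt
  have key : ∀ u : Coord d, deriv (acceleration J) (y 0) * u 0 =
      deriv (acceleration K) (φ y 0) * fderiv ℝ (fun x => φ x 0) y u := fun u => by
    have h1 := hasDerivAt_comp_coord hJ u
    have h2 := h.hasDerivAt_comp_time hK u
    simp only [← h.acceleration_eq i] at h2
    simpa only [h.acceleration_eq i] using h1.unique h2
  -- The spatial direction kills the derivative of the target curvature function, since `∂ᵢT ≠ 0`;
  -- the time direction then kills that of the source.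
  have k1 := key (spaceVec i)
  rw [spaceVec_zero, mul_zero, eq_comm, mul_eq_zero, or_iff_left hQ] at k1
  have k2 := key (timeVec d)
  rw [k1, zero_mul, timeVec_zero, mul_one, hy0] at k2
  exact k2

theorem fderiv_time_space_eq_zero (h : IsRWIsometry J K φ) {t₀ : ℝ} (h1 : deriv J t₀ = 0)
    (h2 : deriv (deriv J) t₀ = 0) {a b : ℝ} (hab : J a ≠ J b) (x : Coord d) (i : Fin d) :
    fderiv ℝ (fun x => φ x 0) x (spaceVec i) = 0 := by
  by_contra hx
  refine hab (eq_of_acceleration_eq_zero h.source_smooth h.source_pos h1 (fun t => ?_) a b)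
  rw [is_const_of_deriv_eq_zero
    ((contDiff_acceleration h.source_smooth h.source_pos).differentiable (by simp))
    (h.deriv_acceleration_eq_zero hx) t t₀]
  exact acceleration_eq_zero_of_flat h.source_smooth h.source_pos h1 h2

theorem eq_sum_vec (u : Coord d) :
    u = u 0 • timeVec d + ∑ i : Fin d, u i.succ • spaceVec i := by
  ext j
  refine Fin.cases ?_ (fun k => ?_) j
  · simp [(Fin.succ_ne_zero _).symm]
  · simp [Fin.succ_ne_zero, Pi.single_apply]

/-- An isometry between Robertson-Walker metrics is affine in time, if the source is not static
and somewhere flat to second order. -/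
theorem exists_affine_time (h : IsRWIsometry J K φ) (i : Fin d) {t₀ : ℝ} (h1 : deriv J t₀ = 0)
    (h2 : deriv (deriv J) t₀ = 0) {a b : ℝ} (hab : J a ≠ J b) :
    ∃ ε s c : ℝ, (ε = 1 ∨ ε = -1) ∧ (∀ x : Coord d, φ x 0 = ε * x 0 + s) ∧
      ∀ t, J t = c * K (ε * t + s) := by
  have hsp := h.fderiv_time_space_eq_zero h1 h2 hab
  have hfd : ∀ x u : Coord d, fderiv ℝ (fun x => φ x 0) x u =
      u 0 * fderiv ℝ (fun x => φ x 0) x (timeVec d) := fun x u => by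
    conv_lhs => rw [eq_sum_vec u]
    rw [map_add, map_sum, map_smul, Finset.sum_eq_zero fun i _ => by rw [map_smul, hsp, smul_zero],
      add_zero, smul_eq_mul]
  have hsq := fun x => h.sq_deriv_time_eq_one (hsp x)
  -- With no spatial gradient, the derivative of `∂ₜT` along `u` is `u 0` times a multiple of `1 -
  -- (∂ₜT)² = 0`.
  have hconst : ∀ x, fderiv ℝ (fun y => fderiv ℝ (fun x => φ x 0) y (timeVec d)) x = 0 := by
    intro x
    ext u
    rw [h.hessian_time, hfd x u, spatialDot_timeVec_right, timeVec_zero]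
    simp only [zero_apply]
    linear_combination (-hubble K (φ x 0) * u 0) * hsq x
  obtain ⟨ε, hε⟩ : ∃ ε, ∀ x, fderiv ℝ (fun x => φ x 0) x (timeVec d) = ε :=
    ⟨_, fun x => is_const_of_fderiv_eq_zero
      ((contDiff_fderiv_apply_const h.contDiff_time _).differentiable (by simp)) hconst x 0⟩
  have hε2 : ε ^ 2 = 1 := by rw [← hε 0]; exact hsq 0
  have hT : ∀ x : Coord d, φ x 0 = ε * x 0 + φ 0 0 := fun x => by
    have hline : ∀ t : ℝ, HasDerivAt (fun s : ℝ => φ ((0 : Coord d) + s • x) 0 - ε * (s * x 0))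
        0 t := fun t => by
      have e1 := hasDerivAt_comp_line (x := 0) (u := x) (t := t)
        (h.contDiff_time.differentiable (by simp) _)
      rw [hfd, hε] at e1
      refine (e1.sub (((hasDerivAt_id t).mul_const (x 0)).const_mul ε)).congr_deriv ?_
      ring
    have := is_const_of_deriv_eq_zero (fun t => (hline t).differentiableAt)
      (fun t => (hline t).deriv) 1 0
    simp only [one_smul, zero_add, zero_smul, one_mul, zero_mul, mul_zero, sub_zero] at this
    linarith
  refine ⟨ε, φ 0 0, J 0 / K (φ 0 0), sq_eq_one_iff.1 hε2, hT, fun t => ?_⟩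
  -- As `∂ᵢT` vanishes identically, the `(i, i)` entry of the Hessian reads `J (H ε - L) = 0`;
  -- integrating it gives `J` proportional to `K ∘ T`. A spatial direction is indispensable here.
  have hH : ∀ t, hubble J t = ε * hubble K (ε * t + φ 0 0) := fun t => by
    have e1 := h.hessian_space_space (t • timeVec d) i
    have e2 : (fun y => fderiv ℝ (fun x => φ x 0) y (spaceVec i)) = fun _ => 0 :=
      funext fun y => hsp y i
    rw [e2, hsp, hε, hT, fderiv_const_apply] at e1
    have e3 : (t • timeVec d) 0 = t := by simp
    rw [e3] at e1
    have e4 : J t * (hubble J t * ε - hubble K (ε * t + φ 0 0)) = 0 := by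
      simpa using e1.symm
    rw [mul_eq_zero, or_iff_right (h.source_pos t).ne'] at e4
    linear_combination ε * e4 - hubble J t * hε2
  have hd : ∀ t, HasDerivAt (fun t => J t / K (ε * t + φ 0 0)) 0 t := fun t => by
    have e1 : HasDerivAt (fun t => ε * t + φ 0 0) ε t := by
      simpa using ((hasDerivAt_id t).const_mul ε).add_const (φ 0 0)
    have e2 := HasDerivAt.comp t
      (hasDerivAt_scale h.target_smooth h.target_pos (ε * t + φ 0 0)) e1
    refine ((hasDerivAt_scale h.source_smooth h.source_pos t).div e2
      (h.target_pos _).ne').congr_deriv ?_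
    rw [div_eq_zero_iff, hH]
    left
    simp only [Function.comp]
    ring
  have := is_const_of_deriv_eq_zero (fun t => (hd t).differentiableAt) (fun t => (hd t).deriv) t 0
  simp only [mul_zero, zero_add] at this
  rw [← this, div_mul_cancel₀ _ (h.target_pos _).ne']

end IsRWIsometry

/-! ### Robertson-Walker spacetimes -/

section RobertsonWalker

variable {d : ℕ}

/-- The bilinear form `dt²`. -/
noncomputable def timeForm (d : ℕ) : BilForm d :=
  (EuclideanSpace.proj (𝕜 := ℝ) (0 : Fin (d + 1))).smulRight
    (EuclideanSpace.proj (𝕜 := ℝ) (0 : Fin (d + 1)))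

/-- The bilinear form `(dx¹)² + ⋯ + (dx^d)²`. -/
noncomputable def spaceForm (d : ℕ) : BilForm d :=
  ∑ i : Fin d, (EuclideanSpace.proj (𝕜 := ℝ) i.succ).smulRight
    (EuclideanSpace.proj (𝕜 := ℝ) i.succ)

/-- The Robertson-Walker metric tensor field with scale factor `J`. -/
noncomputable def rwMetric (d : ℕ) (J : ℝ → ℝ) (x : Coord d) : BilForm d :=
  -timeForm d + J (x 0) • spaceForm d

theorem rwMetric_apply (J : ℝ → ℝ) (x v w : Coord d) :
    rwMetric d J x v w = -(v 0 * w 0) + J (x 0) * spatialDot v w := by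
  simp [rwMetric, timeForm, spaceForm, spatialDot]

theorem contDiff_const_add_smul_const {E F : Type*} [NormedAddCommGroup E] [NormedSpace ℝ E]
    [NormedAddCommGroup F] [NormedSpace ℝ F] (A B : F) {f : E → ℝ} (hf : ContDiff ℝ ∞ f) :
    ContDiff ℝ ∞ fun x => A + f x • B :=
  contDiff_const.add (hf.smul contDiff_const)

theorem contDiff_rwMetric {J : ℝ → ℝ} (hJ : ContDiff ℝ ∞ J) : ContDiff ℝ ∞ (rwMetric d J) := by
  have h0 : ContDiff ℝ ∞ fun x : Coord d => x 0 :=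
    (EuclideanSpace.proj (𝕜 := ℝ) (0 : Fin (d + 1))).contDiff
  exact contDiff_const_add_smul_const (-timeForm d) (spaceForm d) (hJ.comp h0)

theorem isLorentzian_rwMetric {J : ℝ → ℝ} (hpos : ∀ t, 0 < J t) (x : Coord d) :
    IsLorentzian (rwMetric d J x) := by
  have hs : √(J (x 0)) ≠ 0 := (Real.sqrt_pos.2 (hpos _)).ne'
  let u : Fin (d + 1) → ℝˣ := Fin.cons 1 fun _ => (Units.mk0 _ hs)⁻¹
  -- Rescaling the spatial coordinate vectors by `1/√J` makes the form diagonal with entries `±1`.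
  refine ⟨(EuclideanSpace.basisFun (Fin (d + 1)) ℝ).toBasis.unitsSMul u, fun i j => ?_⟩
  rw [rwMetric_apply]
  simp only [Module.Basis.unitsSMul_apply, OrthonormalBasis.coe_toBasis,
    EuclideanSpace.basisFun_apply]
  have hu : ∀ k : Fin d, ((u k.succ : ℝˣ) : ℝ) = (√(J (x 0)))⁻¹ := fun k => by
    simp [u]
  have hu0 : u 0 = 1 := rfl
  have hJ : J (x 0) * ((√(J (x 0)))⁻¹ * (√(J (x 0)))⁻¹) = 1 := by
    rw [← mul_inv, Real.mul_self_sqrt (hpos _).le, mul_inv_cancel₀ (hpos _).ne']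
  refine Fin.cases ?_ (fun k => ?_) i <;> refine Fin.cases ?_ (fun l => ?_) j
  · simp [hu0, spatialDot, Fin.succ_ne_zero]
  · simp [hu0, spatialDot, Fin.succ_ne_zero, (Fin.succ_ne_zero _).symm]
  · simp [hu0, spatialDot, Fin.succ_ne_zero, (Fin.succ_ne_zero _).symm]
  · by_cases hkl : k = l
    · subst hkl
      simp [spatialDot, Fin.succ_ne_zero, (Fin.succ_ne_zero _).symm, Units.smul_def, hu, hJ]
    · simp [spatialDot, (Fin.succ_ne_zero _).symm, Units.smul_def, hu, hkl, Ne.symm hkl]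

/-- The Robertson-Walker spacetime with scale factor `J`. -/
noncomputable def rwSpacetime (d : ℕ) {J : ℝ → ℝ} (hJ : ContDiff ℝ ∞ J) (hpos : ∀ t, 0 < J t) :
    Spacetime d where
  metric := rwMetric d J
  smooth := contDiff_rwMetric hJ
  symm x v w := by rw [rwMetric_apply, rwMetric_apply, mul_comm (v 0), spatialDot_comm]
  lorentzian := isLorentzian_rwMetric hpos

theorem hasRWForm_rwSpacetime {J : ℝ → ℝ} (hJ : ContDiff ℝ ∞ J) (hpos : ∀ t, 0 < J t) :
    HasRWForm J (rwSpacetime d hJ hpos) := fun x v w => rwMetric_apply J x v w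

theorem IsRWIsometry.of_transforms {J K : ℝ → ℝ} (hJ : ContDiff ℝ ∞ J) (hJpos : ∀ t, 0 < J t)
    (hK : ContDiff ℝ ∞ K) (hKpos : ∀ t, 0 < K t) {g g' : Spacetime d} (hg : HasRWForm J g)
    (hg' : HasRWForm K g') {φ : CoordChange d} (h : Transforms φ g g') :
    IsRWIsometry J K φ where
  contDiff := φ.contMDiff.contDiff
  source_smooth := hJ
  source_pos := hJpos
  target_smooth := hK
  target_pos := hKpos
  pullback x v w := by
    have := h x v w
    rwa [hg, hg'] at this
  exists_time x := by
    have h1 := (φ.contMDiff.contDiff.differentiable (by simp) x).hasFDerivAt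
    have h2 := (φ.symm.contMDiff.contDiff.differentiable (by simp) (φ x)).hasFDerivAt
    rw [← φ.symm_apply_apply x] at h1
    have h3 := h1.comp (φ x) h2
    have h4 : (φ ∘ φ.symm) = id := funext fun y => φ.apply_symm_apply y
    rw [h4, φ.symm_apply_apply] at h3
    refine ⟨fderiv ℝ φ.symm (φ x) (timeVec d), ?_⟩
    have := h3.unique (hasFDerivAt_id (φ x))
    exact DFunLike.congr_fun this (timeVec d)

/-- Translations as coordinate changes. -/
noncomputable def translation (v : Coord d) : CoordChange d where
  toEquiv := Equiv.addRight v
  contMDiff_toFun := (contDiff_id.add contDiff_const).contMDiff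
  contMDiff_invFun := (contDiff_id.add contDiff_const).contMDiff

theorem translation_apply (v x : Coord d) : translation v x = x + v := rfl

theorem transforms_translation {J K : ℝ → ℝ} {g g' : Spacetime d} (hg : HasRWForm J g)
    (hg' : HasRWForm K g') {s : ℝ} (h : ∀ t, J t = K (t + s)) :
    Transforms (translation (s • timeVec d)) g g' := by
  intro x v w
  have hf : fderiv ℝ (translation (s • timeVec d)) x = ContinuousLinearMap.id ℝ (Coord d) := by
    have : (translation (s • timeVec d) : Coord d → Coord d) = fun x => x + s • timeVec d := rfl
    rw [this, fderiv_add_const, fderiv_fun_id]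
  rw [hg, hg', hf, h, translation_apply]
  simp

end RobertsonWalker

/-! ### The reduction -/

namespace IsBellCurve

variable {W : ℝ → ℝ}

/-- The map `α ↦ -dt² + W_α(t) dx²`. -/
noncomputable def reduction (d : ℕ) (hW : IsBellCurve W) (α : Bernoulli) : RW d :=
  ⟨rwSpacetime d (hW.contDiff_bellWave α) (hW.bellWave_pos α),
    bellWave W α, hW.contDiff_bellWave α, hW.bellWave_pos α, hasRWForm_rwSpacetime _ _⟩

theorem hasRWForm_reduction (d : ℕ) (hW : IsBellCurve W) (α : Bernoulli) :
    HasRWForm (bellWave W α) (hW.reduction d α : Spacetime d) :=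
  hasRWForm_rwSpacetime (hW.contDiff_bellWave α) (hW.bellWave_pos α)

theorem exists_shift_of_transforms {d : ℕ} (hd : 1 ≤ d) (hW : IsBellCurve W) {α β : Bernoulli}
    {φ : CoordChange d}
    (h : Transforms φ (hW.reduction d α : Spacetime d) (hW.reduction d β : Spacetime d)) :
    ∃ k : ℤ, (∀ x : Coord d, φ x 0 = x 0 - k) ∧ ∀ n : ℤ, α n = β (n - k) := by
  have hφ := IsRWIsometry.of_transforms (hW.contDiff_bellWave α) (hW.bellWave_pos α)
    (hW.contDiff_bellWave β) (hW.bellWave_pos β) (hW.hasRWForm_reduction d α)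
    (hW.hasRWForm_reduction d β) h
  obtain ⟨p, hp0, hp1, -, hp⟩ := hW.exists_peak
  have hne : bellWave W α ((0 : ℤ) + p) ≠ bellWave W α 0 := by
    rw [hp, hW.bellWave_zero]
    intro h0
    have := abs_letterSign (α 0)
    rw [show letterSign (α 0) = 0 by linarith, abs_zero] at this
    exact zero_ne_one this
  obtain ⟨ε, s, c, hε, hT, hJ⟩ := hφ.exists_affine_time ⟨0, hd⟩ (hW.deriv_bellWave_zero α)
    (hW.deriv_deriv_bellWave_zero α) hne
  obtain ⟨k, hk, hαβ⟩ := hW.exists_shift_of_bellWave_eq hε hJ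
  exact ⟨k, fun x => by rw [hT, hk], hαβ⟩

theorem bellWave_congr {α β : Bernoulli} {t : ℝ} (h : α ⌊t⌋ = β ⌊t⌋) :
    bellWave W α t = bellWave W β t := by
  rw [bellWave_eq, bellWave_eq, h]

/-- A compact set meets a bounded range of times. Sequences agreeing on a large enough window give
identical metrics near that set, so all jets on it coincide exactly and no estimate is needed. -/
theorem continuous_reduction (d : ℕ) (hW : IsBellCurve W) : Continuous (hW.reduction d) := by
  refine Continuous.subtype_mk ?_ _
  refine continuous_induced_rng.2 (continuous_iInf_rng.2 fun n => continuous_induced_rng.2 ?_)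
  rw [ContinuousMap.continuous_compactOpen]
  intro C hC U _
  rw [isOpen_iff_mem_nhds]
  intro α hα
  obtain ⟨N, hN⟩ : ∃ N : ℕ, ∀ x ∈ C, |x 0| < N := by
    obtain ⟨R, hR⟩ := hC.isBounded.exists_norm_le
    obtain ⟨N, hN⟩ := exists_nat_gt R
    refine ⟨N, fun x hx => ?_⟩
    have := PiLp.norm_apply_le x 0
    exact this.trans_lt ((hR x hx).trans_lt hN)
  filter_upwards [Bernoulli.setOf_eqOn_mem_nhds α (N + 1)] with β hβ x hx
  have heq : rwMetric d (bellWave W β) =ᶠ[nhds x] rwMetric d (bellWave W α) := by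
    have hopen : IsOpen {y : Coord d | |y 0| < N} :=
      isOpen_lt (by fun_prop) continuous_const
    filter_upwards [hopen.mem_nhds (hN x hx)] with y hy
    have hy' : |y 0| < N := hy
    rw [abs_lt] at hy'
    have h1 : -((N : ℤ)) ≤ ⌊y 0⌋ := Int.le_floor.2 (by push_cast; exact hy'.1.le)
    have h2 : ⌊y 0⌋ < (N : ℤ) := Int.floor_lt.2 (by push_cast; exact hy'.2)
    rw [rwMetric, rwMetric, bellWave_congr (hβ _ (by push_cast; omega) (by push_cast; omega))]
  have hjet : iteratedFDeriv ℝ n (rwMetric d (bellWave W β)) x =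
      iteratedFDeriv ℝ n (rwMetric d (bellWave W α)) x :=
    (heq.iteratedFDeriv ℝ n).self_of_nhds
  have hx' : iteratedFDeriv ℝ n (rwMetric d (bellWave W α)) x ∈ U := hα hx
  rw [← hjet] at hx'
  exact hx'

theorem isBorelReduction_reduction {d : ℕ} (hd : 1 ≤ d) (hW : IsBellCurve W) :
    IsBorelReduction (Multiplicative ℤ) (hW.reduction d) where
  borel_map := (hW.continuous_reduction d).borel_measurable
  reduces α β := by
    rw [MulAction.orbit_eq_iff, MulAction.mem_orbit_iff]
    constructor
    · rintro ⟨k, rfl⟩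
      refine ⟨_, transforms_translation (s := -(k.toAdd : ℤ)) (hW.hasRWForm_reduction d _)
        (hW.hasRWForm_reduction d _) fun t => ?_⟩
      rw [← sub_eq_add_neg]
      exact bellWave_shift β k.toAdd t
    · rintro ⟨φ, hφ⟩
      obtain ⟨k, -, hk⟩ := hW.exists_shift_of_transforms hd hφ
      exact ⟨Multiplicative.ofAdd k, funext fun n => (hk n).symm⟩

end IsBellCurve

theorem mainTheorem4 (d : ℕ) (hd : 1 ≤ d) :
    IsRich (RW d) ∧
    IsGenericallyErgodicPolish (Multiplicative ℤ) Bernoulli ∧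
    (∃ W : ℝ → ℝ, IsBellCurve W) ∧
    ∀ W : ℝ → ℝ, IsBellCurve W →
      ∃ r : Bernoulli → RW d,
        (∀ α : Bernoulli, HasRWForm (bellWave W α) (r α : Spacetime d)) ∧
        Continuous r ∧
        IsBorelReduction (Multiplicative ℤ) r ∧
        ∀ (α β : Bernoulli) (φ : CoordChange d),
          Transforms φ (r α : Spacetime d) (r β : Spacetime d) →
            ∃ k : ℤ, (∀ x : Coord d, φ x 0 = x 0 - k) ∧ ∀ n : ℤ, α n = β (n - k) :=
  ⟨⟨Multiplicative ℤ, Bernoulli, inferInstance, inferInstance, inferInstance, inferInstance,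
      Bernoulli.isGenericallyErgodicPolish, isBellCurve_skewBell.reduction d,
      isBellCurve_skewBell.isBorelReduction_reduction hd⟩,
    Bernoulli.isGenericallyErgodicPolish, ⟨skewBell, isBellCurve_skewBell⟩,
    fun _ hW => ⟨hW.reduction d, hW.hasRWForm_reduction d, hW.continuous_reduction d,
      hW.isBorelReduction_reduction hd, fun _ _ _ h => hW.exists_shift_of_transforms hd h⟩⟩
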